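/- Let $\Bbbk$ be a field and let $f:C\to D$ and $\pi:C\twoheadrightarrow D'$ be morphisms of (coassociative, counital) $\Bbbk$-coalgebras, with $\pi$ surjective. The codominion of $f$ is the smallest regular quotient $q:C\twoheadrightarrow \overline{D}$ in the category of $\Bbbk$-coalgebras through which $f$ factors: $q$ is a coequalizer of a pair of coalgebra morphisms into $C$, $f$ factors through $q$, and $q$ factors through every other such quotient of $C$. We say that $f$ dominates $\pi$ if $\pi$ factors as $C\xrightarrow{q}\overline{D}\to D'$ in the category of coalgebras. The following conditions are equivalent: (a) $f$ dominates $\pi$. (b) For any pair $f_1,f_2:C'\to C$ of coalgebra morphisms with $ff_1=ff_2$ we have $\pi f_1=\pi f_2$. (c) $\pi p_1=\pi p_2$, where $p_1,p_2:C\times_D C\to C$ are the projections of the pullback of $f$ along itself in the category of $\Bbbk$-coalgebras. (d) The two maps $\mathrm{id}_C\otimes\varepsilon,\ \varepsilon\otimes\mathrm{id}_C: C\square_D C\to C$ become equal after composition with $\pi$, where $$C\square_D C=\Big\{\textstyle\sum_i a_i\otimes b_i\in C\otimes C\ \Big|\ \sum_i a_{i,1}\otimes f(a_{i,2})\otimes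 b_i=\sum_i a_i\otimes f(b_{i,1})\otimes b_{i,2}\in C\otimes D\otimes C\Big\}$$ is the cotensor product and $\varepsilon$ is the counit of $C$. (e) For any $C$-bicomodule $X$, with coactions $x\mapsto x_0\otimes x_1\in X\otimes C$ and $x\mapsto x_{-1}\otimes x_0\in C\otimes X$, and any $x\in X$, $$x_0\otimes f(x_1)=x_0\otimes f(x_{-1})\in X\otimes D\ \Longrightarrow\ x_0\otimes\pi(x_1)=x_0\otimes\pi(x_{-1})\in X\otimes D'.$$ (f) The same condition as in (e), but only for finite-dimensional bicomodules $X$. (g) For any linear map $\varphi:V\to W$ between right $C$-comodules with structure maps $\rho_V:V\to V\otimes C$ and $\rho_W:W\to W\otimes C$, if $\varphi$ is a morphism of $D$-comodules via corestriction along $f$ then it is a morphism of $D'$-comodules via corestriction along $\pi$: $(\mathrm{id}_W\otimes f)\circ\rho_W\circ\varphi=(\varphi\otimes f)\circ\rho_V$ implies $(\mathrm{id}_W\otimes\pi)\circ\rho_W\circ\varphi=(\varphi\otimes\pi)\circ\rho_V$. (h) The same condition as in (g), but only for finite-dimensional comodules $V$ and $W$. Moreover, if $f$ factors through $\pi$ (i.e.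 $f=g\pi$ for some coalgebra morphism $g:D'\to D$), then each of these conditions is also equivalent to the existence of coalgebra morphisms $\overline{D}\to D'\to D$ such that $C\xrightarrow{q}\overline{D}\to D'$ equals $\pi$ and the composition $C\xrightarrow{q}\overline{D}\to D'\to D$ equals $f$. -/

import Mathlib

open scoped TensorProduct
open CategoryTheory

universe u

namespace CoalgDom

section Codominion

variable {𝒞 : Type*} [Category 𝒞]

/-- `q : c ⟶ c'` is the codominion of `f : c ⟶ d`: the smallest regular quotient object of `c`
through which `f` factors. A quotient `q` is smaller than a quotient `r` when `q` factors
through `r`. -/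
structure IsCodominion {c d c' : 𝒞} (f : c ⟶ d) (q : c ⟶ c') : Prop where
  regular : IsRegularEpi q
  factors : ∃ g : c' ⟶ d, q ≫ g = f
  smallest : ∀ (e : 𝒞) (r : c ⟶ e), IsRegularEpi r → (∃ g : e ⟶ d, r ≫ g = f) →
    ∃ t : e ⟶ c', r ≫ t = q

/-- `f : c ⟶ d` dominates the quotient object `π : c ⟶ d'`: the quotient `π` factors through the
codominion of `f`. (For epic `π` the factor `p` is automatically epic.) -/
def Dominates {c d d' : 𝒞} (f : c ⟶ d) (π : c ⟶ d') : Prop :=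
  ∃ (c' : 𝒞) (q : c ⟶ c'), IsCodominion f q ∧ ∃ p : c' ⟶ d', q ≫ p = π

/-- The variant of domination in which `d'` is moreover required to lie between the codominion
and `d`: there is a factorization `c ⟶ c' ⟶ d' ⟶ d` of `f`, with `c ⟶ c'` the codominion of `f`
and `c ⟶ c' ⟶ d'` equal to `π`. -/
def DominatesBetween {c d d' : 𝒞} (f : c ⟶ d) (π : c ⟶ d') : Prop :=
  ∃ (c' : 𝒞) (q : c ⟶ c') (p : c' ⟶ d') (g : d' ⟶ d),
    IsCodominion f q ∧ q ≫ p = π ∧ q ≫ p ≫ g = f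

end Codominion

section Comodules

variable (k : Type*) [Field k]

/-- A right comodule structure `v ↦ v₀ ⊗ v₁` over the coalgebra `C` on the vector space `V`. -/
structure RightComodule (C : Type*) [AddCommGroup C] [Module k C] [Coalgebra k C]
    (V : Type*) [AddCommGroup V] [Module k V] where
  coact : V →ₗ[k] V ⊗[k] C
  coassoc : (TensorProduct.assoc k V C C).toLinearMap ∘ₗ coact.rTensor C ∘ₗ coact =
    (Coalgebra.comul (R := k) (A := C)).lTensor V ∘ₗ coact
  counit : (Coalgebra.counit (R := k) (A := C)).lTensor V ∘ₗ coact =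
    (TensorProduct.mk k V k).flip 1

/-- A left comodule structure `v ↦ v₋₁ ⊗ v₀` over the coalgebra `C` on the vector space `V`. -/
structure LeftComodule (C : Type*) [AddCommGroup C] [Module k C] [Coalgebra k C]
    (V : Type*) [AddCommGroup V] [Module k V] where
  coact : V →ₗ[k] C ⊗[k] V
  coassoc : (TensorProduct.assoc k C C V).toLinearMap ∘ₗ
      (Coalgebra.comul (R := k) (A := C)).rTensor V ∘ₗ coact = coact.lTensor C ∘ₗ coact
  counit : (Coalgebra.counit (R := k) (A := C)).rTensor V ∘ₗ coact = TensorProduct.mk k k V 1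

/-- A `C`-bicomodule structure on `X`: commuting left and right `C`-comodule structures. -/
structure Bicomodule (C : Type*) [AddCommGroup C] [Module k C] [Coalgebra k C]
    (X : Type*) [AddCommGroup X] [Module k X] where
  left : LeftComodule k C X
  right : RightComodule k C X
  comm : (TensorProduct.assoc k C X C).toLinearMap ∘ₗ left.coact.rTensor C ∘ₗ right.coact =
    right.coact.lTensor C ∘ₗ left.coact

variable {k}
variable {C : Type*} [AddCommGroup C] [Module k C] [Coalgebra k C]
variable {D : Type*} [AddCommGroup D] [Module k D] [Coalgebra k D]
variable {V : Type*} [AddCommGroup V] [Module k V]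
variable {W : Type*} [AddCommGroup W] [Module k W]

/-- Corestriction of a right `C`-comodule to a right `D`-comodule along `f : C → D`. -/
def RightComodule.corestrict (M : RightComodule k C V) (f : C →ₗc[k] D) :
    RightComodule k D V where
  coact := f.toLinearMap.lTensor V ∘ₗ M.coact
  coassoc := by
    have h := congrArg (fun g => (TensorProduct.map f.toLinearMap f.toLinearMap).lTensor V ∘ₗ g)
      M.coassoc
    have h2 : (TensorProduct.map f.toLinearMap f.toLinearMap) ∘ₗ Coalgebra.comul =
      Coalgebra.comul ∘ₗ f.toLinearMap := f.map_comp_comul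
    have h3 : (TensorProduct.assoc k V D D).toLinearMap ∘ₗ
          (f.toLinearMap.lTensor V ∘ₗ M.coact).rTensor D ∘ₗ f.toLinearMap.lTensor V =
        (TensorProduct.map f.toLinearMap f.toLinearMap).lTensor V ∘ₗ
          (TensorProduct.assoc k V C C).toLinearMap ∘ₗ M.coact.rTensor C := by
      ext v c
      simp only [LinearMap.coe_comp, Function.comp_apply,
        TensorProduct.AlgebraTensorModule.curry_apply, LinearMap.restrictScalars_self,
        TensorProduct.curry_apply, LinearMap.lTensor_tmul, LinearMap.rTensor_tmul,
        LinearEquiv.coe_coe]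
      induction M.coact v using TensorProduct.induction_on with
      | zero => simp
      | tmul x y => simp
      | add x y hx hy => simp only [map_add, TensorProduct.add_tmul, hx, hy]
    have h4 := congrArg (fun g => g ∘ₗ M.coact) h3
    have h5 := congrArg (fun g => g.lTensor V ∘ₗ M.coact) h2
    simp only [LinearMap.lTensor_comp, LinearMap.comp_assoc] at h h4 h5 ⊢
    rw [h4, h, h5]
  counit := by
    rw [← LinearMap.comp_assoc, ← LinearMap.lTensor_comp,
      show Coalgebra.counit ∘ₗ f.toLinearMap = Coalgebra.counit from f.counit_comp]
    exact M.counit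

/-- Corestriction of a left `C`-comodule to a left `D`-comodule along `f : C → D`. -/
def LeftComodule.corestrict (M : LeftComodule k C V) (f : C →ₗc[k] D) :
    LeftComodule k D V where
  coact := f.toLinearMap.rTensor V ∘ₗ M.coact
  coassoc := by
    have h := congrArg (fun g => TensorProduct.map f.toLinearMap (f.toLinearMap.rTensor V) ∘ₗ g)
      M.coassoc
    have h2 : (TensorProduct.map f.toLinearMap f.toLinearMap) ∘ₗ Coalgebra.comul =
      Coalgebra.comul ∘ₗ f.toLinearMap := f.map_comp_comul
    have h3 : (f.toLinearMap.rTensor V ∘ₗ M.coact).lTensor D ∘ₗ f.toLinearMap.rTensor V =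
        TensorProduct.map f.toLinearMap (f.toLinearMap.rTensor V) ∘ₗ M.coact.lTensor C := by
      ext; simp
    have h4 : (TensorProduct.assoc k D D V).toLinearMap ∘ₗ
          (TensorProduct.map f.toLinearMap f.toLinearMap).rTensor V =
        TensorProduct.map f.toLinearMap (f.toLinearMap.rTensor V) ∘ₗ
          (TensorProduct.assoc k C C V).toLinearMap := by
      ext; simp
    have h5 := congrArg (fun g => g.rTensor V) h2
    simp only [LinearMap.rTensor_comp] at h5
    calc _ = (TensorProduct.assoc k D D V).toLinearMap ∘ₗ
          ((Coalgebra.comul (R := k) (A := D)).rTensor V ∘ₗ f.toLinearMap.rTensor V) ∘ₗ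
            M.coact := rfl
      _ = ((TensorProduct.assoc k D D V).toLinearMap ∘ₗ
          (TensorProduct.map f.toLinearMap f.toLinearMap).rTensor V) ∘ₗ
            (Coalgebra.comul (R := k) (A := C)).rTensor V ∘ₗ M.coact := by rw [← h5]; rfl
      _ = (TensorProduct.map f.toLinearMap (f.toLinearMap.rTensor V) ∘ₗ M.coact.lTensor C) ∘ₗ
            M.coact := by rw [h4]; exact h
      _ = _ := by rw [← h3]; rfl
  counit := by
    rw [← LinearMap.comp_assoc, ← LinearMap.rTensor_comp,
      show Coalgebra.counit ∘ₗ f.toLinearMap = Coalgebra.counit from f.counit_comp]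
    exact M.counit

variable (k C) in
/-- `C` as a right comodule over itself. -/
def RightComodule.regular : RightComodule k C C where
  coact := Coalgebra.comul
  coassoc := Coalgebra.coassoc
  counit := Coalgebra.lTensor_counit_comp_comul

variable (k C) in
/-- `C` as a left comodule over itself. -/
def LeftComodule.regular : LeftComodule k C C where
  coact := Coalgebra.comul
  coassoc := Coalgebra.coassoc
  counit := Coalgebra.rTensor_counit_comp_comul

/-- A linear map `φ : V → W` between right comodules is a comodule morphism. -/
def IsColinear (M : RightComodule k D V) (N : RightComodule k D W) (φ : V →ₗ[k] W) : Prop :=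
  N.coact ∘ₗ φ = φ.rTensor D ∘ₗ M.coact

/-- The cotensor product `V □_D W ⊆ V ⊗ W`. -/
def cotensor (M : RightComodule k D V) (N : LeftComodule k D W) : Submodule k (V ⊗[k] W) :=
  LinearMap.eqLocus ((TensorProduct.assoc k V D W).toLinearMap ∘ₗ M.coact.rTensor W)
    (N.coact.lTensor V)

/-- `C □_D C`, where `C` is a `D`-comodule on both sides through `f : C → D`. -/
def selfCotensor (f : C →ₗc[k] D) : Submodule k (C ⊗[k] C) :=
  cotensor ((RightComodule.regular k C).corestrict f) ((LeftComodule.regular k C).corestrict f)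

variable (k C) in
/-- The map `id ⊗ ε : C ⊗ C → C`. -/
def idTensorCounit : C ⊗[k] C →ₗ[k] C :=
  (TensorProduct.rid k C).toLinearMap ∘ₗ (Coalgebra.counit (R := k) (A := C)).lTensor C

variable (k C) in
/-- The map `ε ⊗ id : C ⊗ C → C`. -/
def counitTensorId : C ⊗[k] C →ₗ[k] C :=
  (TensorProduct.lid k C).toLinearMap ∘ₗ (Coalgebra.counit (R := k) (A := C)).rTensor C

/-- For `x` in a `C`-bicomodule, the identity `x₀ ⊗ f(x₁) = x₀ ⊗ f(x₋₁)` in `X ⊗ D`. -/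
def Bicomodule.IsCentral {X : Type*} [AddCommGroup X] [Module k X] (B : Bicomodule k C X)
    (f : C →ₗc[k] D) (x : X) : Prop :=
  f.toLinearMap.lTensor X (B.right.coact x) =
    TensorProduct.comm k D X (f.toLinearMap.rTensor X (B.left.coact x))

end Comodules

section Conditions

variable {k : Type u} [Field k]
variable {C : Type u} [AddCommGroup C] [Module k C] [Coalgebra k C]
variable {D : Type u} [AddCommGroup D] [Module k D] [Coalgebra k D]
variable {D' : Type u} [AddCommGroup D'] [Module k D'] [Coalgebra k D']

/-- Any two coalgebra morphisms into `C` equalized by `f` are equalized by `π`. -/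
def EqualizesPairs (f : C →ₗc[k] D) (π : C →ₗc[k] D') : Prop :=
  ∀ (C' : Type u) [AddCommGroup C'] [Module k C'] [Coalgebra k C'] (f₁ f₂ : C' →ₗc[k] C),
    f.comp f₁ = f.comp f₂ → π.comp f₁ = π.comp f₂

/-- `π` coequalizes the two projections of the pullback `C ×_D C` in the category of
coalgebras. -/
def CoequalizesPullback (f : C →ₗc[k] D) (π : C →ₗc[k] D') : Prop :=
  ∃ (P : CoalgCat.{u} k) (p₁ p₂ : P ⟶ CoalgCat.of k C),
    IsPullback p₁ p₂ (CoalgCat.ofHom f) (CoalgCat.ofHom f) ∧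
      p₁ ≫ CoalgCat.ofHom π = p₂ ≫ CoalgCat.ofHom π

/-- `π` coequalizes the two maps `id ⊗ ε, ε ⊗ id : C □_D C → C`. -/
def CoequalizesCotensor (f : C →ₗc[k] D) (π : C →ₗc[k] D') : Prop :=
  π.toLinearMap ∘ₗ idTensorCounit k C ∘ₗ (selfCotensor f).subtype =
    π.toLinearMap ∘ₗ counitTensorId k C ∘ₗ (selfCotensor f).subtype

/-- `x₀ ⊗ f(x₁) = x₀ ⊗ f(x₋₁)` implies `x₀ ⊗ π(x₁) = x₀ ⊗ π(x₋₁)` in all `C`-bicomodules. -/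
def BicomoduleCondition (f : C →ₗc[k] D) (π : C →ₗc[k] D') : Prop :=
  ∀ (X : Type u) [AddCommGroup X] [Module k X] (B : Bicomodule k C X) (x : X),
    B.IsCentral f x → B.IsCentral π x

/-- The bicomodule condition for finite-dimensional bicomodules only. -/
def FiniteBicomoduleCondition (f : C →ₗc[k] D) (π : C →ₗc[k] D') : Prop :=
  ∀ (X : Type u) [AddCommGroup X] [Module k X] [FiniteDimensional k X] (B : Bicomodule k C X)
    (x : X), B.IsCentral f x → B.IsCentral π x

/-- Linear maps of right `C`-comodules that are `D`-colinear via `f` are `D'`-colinear via `π`. -/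
def ColinearCondition (f : C →ₗc[k] D) (π : C →ₗc[k] D') : Prop :=
  ∀ (V W : Type u) [AddCommGroup V] [Module k V] [AddCommGroup W] [Module k W]
    (M : RightComodule k C V) (N : RightComodule k C W) (φ : V →ₗ[k] W),
    IsColinear (M.corestrict f) (N.corestrict f) φ →
      IsColinear (M.corestrict π) (N.corestrict π) φ

/-- The colinearity condition for finite-dimensional comodules only. -/
def FiniteColinearCondition (f : C →ₗc[k] D) (π : C →ₗc[k] D') : Prop :=
  ∀ (V W : Type u) [AddCommGroup V] [Module k V] [AddCommGroup W] [Module k W]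
    [FiniteDimensional k V] [FiniteDimensional k W]
    (M : RightComodule k C V) (N : RightComodule k C W) (φ : V →ₗ[k] W),
    IsColinear (M.corestrict f) (N.corestrict f) φ →
      IsColinear (M.corestrict π) (N.corestrict π) φ

end Conditions

end CoalgDom

/-!
The comatrix coalgebras separate morphisms of coalgebras, because every element of a coalgebra lies
in the image of one of them. Hence the cocomplete category of coalgebras is also complete, the
codominion of `f` is the coequalizer of the projections of the pullback of `f` along itself, and
(a) and (c) both reduce to (b).

A comodule structure on a finite-dimensional space is the same as a morphism from a comatrix
coalgebra, so under (b) the corestriction along `f` of such a structure determines its corestriction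
along `π`; this yields (h) for isomorphisms, and a linear map `φ : V → W` is colinear exactly when
the shear `(v, w) ↦ (v, w + φ v)` of `V × W` is. Passing to finite-dimensional subcomodules gives
(g). The map `id ⊗ ε` on the subcomodule `C □_D C` of the cofree comodule `C ⊗ C` is `D`-colinear,
and its `D'`-colinearity is (d). Finally (d) implies (b), as `f₁(x₁) ⊗ f₂(x₂)` lies in `C □_D C`
when `f f₁ = f f₂`.

For a central element `x` of a bicomodule and a functional `l`, the tensor `l(x₀) x₁ ⊗ x₋₁` lies in
`C □_D C`, so (d) implies (e). Conversely, let `C` coact on a comatrix coalgebra from the left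
through `g` and from the right through `h`: the identity matrix, whose comultiplication
`∑ i j, E_ij ⊗ E_ji` is symmetric, satisfies the condition of (f) for `f` exactly when `f g = f h`.
-/

namespace CoalgDom

section Codominion

open Limits

variable {𝒞 : Type*} [Category 𝒞] {c d d' : 𝒞} {f : c ⟶ d} {π : c ⟶ d'}

theorem isCodominion_coequalizer {p : 𝒞} {p₁ p₂ : p ⟶ c} (hp : IsPullback p₁ p₂ f f)
    [HasCoequalizer p₁ p₂] : IsCodominion f (coequalizer.π p₁ p₂) where
  regular := ⟨⟨⟨p, p₁, p₂, coequalizer.condition p₁ p₂, coequalizerIsCoequalizer p₁ p₂⟩⟩⟩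
  factors := ⟨coequalizer.desc f hp.w, coequalizer.π_desc f hp.w⟩
  smallest := by
    rintro e r ⟨⟨x, a, b, hab, hr⟩⟩ ⟨g, rfl⟩
    have hfab : a ≫ r ≫ g = b ≫ r ≫ g := by rw [reassoc_of% hab]
    have hq : a ≫ coequalizer.π p₁ p₂ = b ≫ coequalizer.π p₁ p₂ := by
      rw [← hp.lift_fst a b hfab, Category.assoc, coequalizer.condition, hp.lift_snd_assoc]
    exact ⟨Cofork.IsColimit.desc hr _ hq, Cofork.IsColimit.π_desc' hr _ hq⟩

theorem IsCodominion.comp_eq_comp [HasCoequalizers 𝒞] {c' : 𝒞} {q : c ⟶ c'}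
    (hq : IsCodominion f q) {x : 𝒞} {a b : x ⟶ c} (hab : a ≫ f = b ≫ f) : a ≫ q = b ≫ q := by
  obtain ⟨t, rfl⟩ := hq.smallest _ (coequalizer.π a b)
    ⟨⟨⟨x, a, b, coequalizer.condition a b, coequalizerIsCoequalizer a b⟩⟩⟩
    ⟨coequalizer.desc f hab, coequalizer.π_desc f hab⟩
  rw [coequalizer.condition_assoc]

theorem dominates_iff_forall_comp_eq_comp [HasPullback f f] [HasCoequalizers 𝒞] :
    Dominates f π ↔ ∀ ⦃x : 𝒞⦄ (a b : x ⟶ c), a ≫ f = b ≫ f → a ≫ π = b ≫ π := by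
  constructor
  · rintro ⟨c', q, hq, p, rfl⟩ x a b hab
    rw [reassoc_of% hq.comp_eq_comp hab]
  · intro h
    have hπ := h _ _ (pullback.condition (f := f) (g := f))
    exact ⟨_, _, isCodominion_coequalizer (IsPullback.of_hasPullback f f),
      coequalizer.desc π hπ, coequalizer.π_desc π hπ⟩

theorem dominatesBetween_iff_dominates (h : ∃ g : d' ⟶ d, π ≫ g = f) :
    DominatesBetween f π ↔ Dominates f π := by
  obtain ⟨g, rfl⟩ := h
  constructor
  · rintro ⟨c', q, p, -, hq, hp, -⟩
    exact ⟨c', q, hq, p, hp⟩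
  · rintro ⟨c', q, hq, p, rfl⟩
    exact ⟨c', q, p, g, hq, rfl, (Category.assoc _ _ _).symm⟩

end Codominion

section CoalgebraColimits

open Limits

variable {R : Type u} [CommRing R]
variable {A : Type*} [AddCommGroup A] [Module R A] [Coalgebra R A]
variable {B : Type*} [AddCommGroup B] [Module R B] [Coalgebra R B]
variable {E : Type*} [AddCommGroup E] [Module R E] [Coalgebra R E]

theorem exists_comp_eq_of_ker_le_ker {q : A →ₗc[R] B} (hq : Function.Surjective q)
    {g : A →ₗc[R] E} (h : LinearMap.ker q.toLinearMap ≤ LinearMap.ker g.toLinearMap) :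
    ∃ φ : B →ₗc[R] E, φ.comp q = g := by
  let e := q.toLinearMap.quotKerEquivOfSurjective hq
  let φ : B →ₗ[R] E := (LinearMap.ker q.toLinearMap).liftQ g.toLinearMap h ∘ₗ e.symm
  have hφ : φ ∘ₗ q.toLinearMap = g.toLinearMap := by
    ext x
    have he : e.symm (q x) = Submodule.Quotient.mk x := e.symm_apply_eq.2 rfl
    change Submodule.liftQ _ g.toLinearMap h (e.symm (q x)) = g x
    rw [he]
    rfl
  refine ⟨{ toLinearMap := φ, counit_comp := ?_, map_comp_comul := ?_ },
    CoalgHom.ext (LinearMap.congr_fun hφ)⟩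
  · rw [← LinearMap.cancel_right hq, LinearMap.comp_assoc, hφ, g.counit_comp, q.counit_comp]
  · rw [← LinearMap.cancel_right hq, LinearMap.comp_assoc, ← q.map_comp_comul,
      ← LinearMap.comp_assoc, ← TensorProduct.map_comp, hφ, g.map_comp_comul,
      LinearMap.comp_assoc, hφ]

instance isCoideal_range_sub (a b : A →ₗc[R] B) :
    (LinearMap.range (a.toLinearMap - b.toLinearMap)).IsCoideal where
  counit_eq_zero := by
    rintro _ ⟨x, rfl⟩
    simp
  map_mkQ_comul_eq_zero := by
    set I := LinearMap.range (a.toLinearMap - b.toLinearMap)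
    have hI : I.mkQ ∘ₗ a.toLinearMap = I.mkQ ∘ₗ b.toLinearMap := by
      rw [← sub_eq_zero, ← LinearMap.comp_sub, LinearMap.range_mkQ_comp]
    have hcomul (g : A →ₗc[R] B) :
        TensorProduct.map I.mkQ I.mkQ ∘ₗ Coalgebra.comul ∘ₗ g.toLinearMap =
        TensorProduct.map (I.mkQ ∘ₗ g.toLinearMap) (I.mkQ ∘ₗ g.toLinearMap) ∘ₗ
          Coalgebra.comul := by
      rw [← g.map_comp_comul, ← LinearMap.comp_assoc, TensorProduct.map_comp]
    rintro _ ⟨x, rfl⟩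
    have hx := LinearMap.congr_fun ((hcomul a).trans (hI ▸ (hcomul b).symm)) x
    simpa [sub_eq_zero] using hx

instance hasCoequalizers_coalgCat : HasCoequalizers (CoalgCat.{u} R) := by
  have (X Y : CoalgCat.{u} R) (a b : X ⟶ Y) : HasColimit (parallelPair a b) := by
    let I := LinearMap.range (a.toCoalgHom.toLinearMap - b.toCoalgHom.toLinearMap)
    let q : Y →ₗc[R] Y ⧸ I := Coalgebra.Quotient.mkQCoalgHom I
    have hq : Function.Surjective q := I.mkQ_surjective
    have hab : a ≫ CoalgCat.ofHom q = b ≫ CoalgCat.ofHom q :=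
      CoalgCat.hom_ext _ _ (CoalgHom.ext fun x => (Submodule.Quotient.eq I).2 ⟨x, rfl⟩)
    have hdesc (s : Cofork a b) : ∃ φ : Y ⧸ I →ₗc[R] s.pt, φ.comp q = s.π.toCoalgHom := by
      refine exists_comp_eq_of_ker_le_ker hq ?_
      rw [show LinearMap.ker q.toLinearMap = I from I.ker_mkQ]
      rintro _ ⟨x, rfl⟩
      simpa [sub_eq_zero] using CoalgHom.congr_fun (congr(($s.condition).toCoalgHom)) x
    choose φ hφ using hdesc
    refine ⟨_, Cofork.IsColimit.mk (Cofork.ofπ (CoalgCat.ofHom q) hab)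
      (fun s => CoalgCat.ofHom (φ s)) (fun s => CoalgCat.hom_ext _ _ (hφ s)) fun s m hm => ?_⟩
    refine CoalgCat.hom_ext _ _ (CoalgHom.ext (hq.forall.2 fun y => ?_))
    exact CoalgHom.congr_fun (congr(($hm).toCoalgHom).trans (hφ s).symm) y
  exact hasCoequalizers_of_hasColimit_parallelPair _

section Coproducts

variable {J : Type*} [DecidableEq J] {F : J → Type*} [∀ j, AddCommGroup (F j)]
  [∀ j, Module R (F j)] [∀ j, Coalgebra R (F j)]

variable (R F) in
/-- The inclusion of a summand into a direct sum of coalgebras. -/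
def directSumInclusion (j : J) : F j →ₗc[R] Π₀ j, F j where
  __ := DFinsupp.lsingle j
  counit_comp := DFinsupp.counit_comp_lsingle R J F j
  map_comp_comul := (DFinsupp.comul_comp_lsingle R J F j).symm

/-- The morphism from a direct sum of coalgebras given by a family of morphisms: its universal
property as a coproduct. -/
def directSumDesc (g : ∀ j, F j →ₗc[R] E) : (Π₀ j, F j) →ₗc[R] E where
  __ := DFinsupp.lsum R fun j => (g j).toLinearMap
  counit_comp := by
    ext j x
    simp
  map_comp_comul := by
    ext j x
    have hg : (DFinsupp.lsum R fun j => (g j).toLinearMap) ∘ₗ DFinsupp.lsingle j =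
        (g j).toLinearMap := by
      ext
      simp
    have hcomul := LinearMap.congr_fun (g j).map_comp_comul x
    simpa [TensorProduct.map_map, -CoalgHom.toLinearMap_eq_coe, hg] using hcomul

theorem directSumDesc_comp_directSumInclusion (g : ∀ j, F j →ₗc[R] E) (j : J) :
    (directSumDesc g).comp (directSumInclusion R F j) = g j :=
  CoalgHom.ext fun x => DFinsupp.lsum_single R (fun j => (g j).toLinearMap) j x

theorem directSum_hom_ext {φ ψ : (Π₀ j, F j) →ₗc[R] E}
    (h : ∀ j, φ.comp (directSumInclusion R F j) = ψ.comp (directSumInclusion R F j)) : φ = ψ :=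
  CoalgHom.coe_linearMap_injective <| DFinsupp.lhom_ext' fun j =>
    LinearMap.ext fun x => CoalgHom.congr_fun (h j) x

end Coproducts

instance hasCoproducts_coalgCat : HasCoproducts.{u} (CoalgCat.{u} R) := by
  classical
  refine hasCoproducts_of_colimit_cofans
    (fun {J} X => Cofan.mk (CoalgCat.of R (Π₀ j : J, X j)) fun j =>
      CoalgCat.ofHom (directSumInclusion R (fun j => X j) j))
    fun X => Cofan.IsColimit.mk _
      (fun s => CoalgCat.ofHom (directSumDesc fun j => (s.inj j).toCoalgHom))
      (fun s j => CoalgCat.hom_ext _ _ (directSumDesc_comp_directSumInclusion _ j))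
      fun s m hm => CoalgCat.hom_ext _ _ (directSum_hom_ext fun j => ?_)
  exact congr(($(hm j)).toCoalgHom).trans
    (directSumDesc_comp_directSumInclusion (fun j => (s.inj j).toCoalgHom) j).symm

instance hasColimits_coalgCat : HasColimits (CoalgCat.{u} R) :=
  has_colimits_of_hasCoequalizers_and_coproducts

variable {X Y : CoalgCat.{u} R}

/- The two inclusions of `Y` into the cokernel pair of `q`, which is computed in modules,
agree only on the image of `q`. -/
theorem surjective_of_epi (q : X ⟶ Y) [Epi q] : Function.Surjective q.toCoalgHom := by
  let inl : Y →ₗc[R] Y × Y :=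
    { LinearMap.inl R Y Y with
      counit_comp := Prod.counit_comp_inl R Y Y
      map_comp_comul := (Prod.comul_comp_inl R Y Y).symm }
  let inr : Y →ₗc[R] Y × Y :=
    { LinearMap.inr R Y Y with
      counit_comp := Prod.counit_comp_inr R Y Y
      map_comp_comul := (Prod.comul_comp_inr R Y Y).symm }
  let I := LinearMap.range
    ((inl.comp q.toCoalgHom).toLinearMap - (inr.comp q.toCoalgHom).toLinearMap)
  let p : (Y × Y) →ₗc[R] (Y × Y) ⧸ I := Coalgebra.Quotient.mkQCoalgHom I
  have h : (CoalgCat.ofHom (p.comp inl) : Y ⟶ CoalgCat.of R ((Y × Y) ⧸ I)) =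
      CoalgCat.ofHom (p.comp inr) := by
    rw [← cancel_epi q]
    exact CoalgCat.hom_ext _ _ (CoalgHom.ext fun x => (Submodule.Quotient.eq I).2 ⟨x, rfl⟩)
  intro y
  obtain ⟨x, hx⟩ := (Submodule.Quotient.eq I).1 (CoalgHom.congr_fun congr(($h).toCoalgHom) y)
  refine ⟨x, ?_⟩
  simpa only [sub_zero] using (congr(($hx).1) : q.toCoalgHom x - 0 = y - 0)

instance wellPowered_coalgCat_op : WellPowered.{u} (CoalgCat.{u} R)ᵒᵖ where
  subobject_small X := by
    let κ (P : Subobject X) : Submodule R X.unop :=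
      LinearMap.ker P.arrow.unop.toCoalgHom.toLinearMap
    have hκ {P Q : Subobject X} (h : κ Q ≤ κ P) : P ≤ Q := by
      obtain ⟨φ, hφ⟩ := exists_comp_eq_of_ker_le_ker (surjective_of_epi Q.arrow.unop) h
      exact Subobject.le_of_comm (Quiver.Hom.op (CoalgCat.ofHom φ))
        (congrArg Quiver.Hom.op (CoalgCat.hom_ext _ _ hφ))
    exact small_of_injective (f := κ) fun P Q h => le_antisymm (hκ h.ge) (hκ h.le)

end CoalgebraColimits

section Slices

variable {R : Type*} [CommRing R]
variable {V : Type*} [AddCommGroup V] [Module R V]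
variable {W : Type*} [AddCommGroup W] [Module R W]
variable {C : Type*} [AddCommGroup C] [Module R C]

/-- The slice map `v ⊗ c ↦ α(c) v`, linear in the functional `α`. -/
def rightSlice : Module.Dual R C →ₗ[R] V ⊗[R] C →ₗ[R] V :=
  (TensorProduct.rid R V).toLinearMap.compRight R ∘ₗ LinearMap.lTensorHom V

/-- The slice map `v ⊗ c ↦ l(v) c`, linear in the functional `l`. -/
def leftSlice : Module.Dual R V →ₗ[R] V ⊗[R] C →ₗ[R] C :=
  (TensorProduct.lid R C).toLinearMap.compRight R ∘ₗ LinearMap.rTensorHom C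

@[simp]
theorem rightSlice_tmul (α : Module.Dual R C) (v : V) (c : C) :
    rightSlice α (v ⊗ₜ[R] c) = α c • v := rfl

@[simp]
theorem leftSlice_tmul (l : Module.Dual R V) (v : V) (c : C) :
    leftSlice l (v ⊗ₜ[R] c) = l v • c := rfl

theorem rightSlice_comp_rTensor (α : Module.Dual R C) (g : V →ₗ[R] W) :
    rightSlice α ∘ₗ g.rTensor C = g ∘ₗ rightSlice α := by
  ext
  simp

theorem leftSlice_comp_lTensor {E : Type*} [AddCommGroup E] [Module R E] (l : Module.Dual R V)
    (g : C →ₗ[R] E) : leftSlice l ∘ₗ g.lTensor V = g ∘ₗ leftSlice l := by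
  ext
  simp

theorem rightSlice_comp_assoc_symm (α : Module.Dual R C) :
    rightSlice α ∘ₗ (TensorProduct.assoc R V W C).symm.toLinearMap = (rightSlice α).lTensor V := by
  ext
  simp

theorem leftSlice_comp_assoc (l : Module.Dual R V) :
    leftSlice l ∘ₗ (TensorProduct.assoc R V W C).toLinearMap = (leftSlice l).rTensor C := by
  ext
  simp [TensorProduct.smul_tmul']

theorem lTensor_rightSlice_comp_assoc (α : Module.Dual R C) :
    (rightSlice α).lTensor V ∘ₗ (TensorProduct.assoc R V W C).toLinearMap = rightSlice α := by
  ext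
  simp

theorem eq_of_leftSlice_coord_eq {ι : Type*} (b : Module.Basis ι R V) {s t : V ⊗[R] C}
    (h : ∀ i, leftSlice (b.coord i) s = leftSlice (b.coord i) t) : s = t := by
  classical
  refine (TensorProduct.equivFinsuppOfBasisLeft b).injective (Finsupp.ext fun i => ?_)
  rw [TensorProduct.equivFinsuppOfBasisLeft_apply, TensorProduct.equivFinsuppOfBasisLeft_apply]
  exact h i

theorem eq_of_leftSlice_eq [Module.Free R V] {s t : V ⊗[R] C}
    (h : ∀ l : Module.Dual R V, leftSlice l s = leftSlice l t) : s = t :=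
  eq_of_leftSlice_coord_eq (Module.Free.chooseBasis R V) fun _ => h _

theorem eq_of_rightSlice_eq [Module.Free R C] {s t : V ⊗[R] C}
    (h : ∀ α : Module.Dual R C, rightSlice α s = rightSlice α t) : s = t := by
  classical
  let b := Module.Free.chooseBasis R C
  refine (TensorProduct.equivFinsuppOfBasisRight b).injective (Finsupp.ext fun i => ?_)
  rw [TensorProduct.equivFinsuppOfBasisRight_apply, TensorProduct.equivFinsuppOfBasisRight_apply]
  exact h (b.coord i)

theorem mem_range_rTensor_subtype_iff [Module.Free R C] {U : Submodule R V} {t : V ⊗[R] C} :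
    t ∈ LinearMap.range (U.subtype.rTensor C) ↔ ∀ α : Module.Dual R C, rightSlice α t ∈ U := by
  have hslice (α : Module.Dual R C) :
      rightSlice α (U.mkQ.rTensor C t) = U.mkQ (rightSlice α t) :=
    LinearMap.congr_fun (rightSlice_comp_rTensor α U.mkQ) t
  rw [← LinearMap.exact_iff.1 (rTensor_exact C (LinearMap.exact_subtype_mkQ U) U.mkQ_surjective),
    LinearMap.mem_ker]
  constructor
  · intro h α
    rw [← Submodule.Quotient.mk_eq_zero, ← Submodule.mkQ_apply, ← hslice, h, map_zero]
  · intro h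
    refine eq_of_rightSlice_eq fun α => ?_
    rw [hslice, map_zero, Submodule.mkQ_apply, (Submodule.Quotient.mk_eq_zero U).2 (h α)]

theorem fg_range_rightSlice_flip [IsNoetherianRing R] (t : V ⊗[R] C) :
    (LinearMap.range (rightSlice.flip t)).FG := by
  induction t with
  | zero =>
    rw [map_zero, LinearMap.range_zero]
    exact Submodule.fg_bot
  | tmul v c =>
    refine (Submodule.fg_span_singleton v).of_le ?_
    rintro _ ⟨α, rfl⟩
    exact Submodule.smul_mem _ _ (Submodule.mem_span_singleton_self v)
  | add s t hs ht =>
    refine (hs.sup ht).of_le ?_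
    rintro _ ⟨α, rfl⟩
    rw [map_add, LinearMap.add_apply]
    exact Submodule.add_mem_sup ⟨α, rfl⟩ ⟨α, rfl⟩

end Slices

section MatrixCoefficients

variable {k : Type*} [Field k]
variable {C : Type*} [AddCommGroup C] [Module k C] [Coalgebra k C]
variable {D : Type*} [AddCommGroup D] [Module k D] [Coalgebra k D]
variable {V : Type*} [AddCommGroup V] [Module k V]

attribute [ext] RightComodule

/-- The matrix coefficient `v ↦ l(v₀) v₁` of a right comodule. -/
def RightComodule.matrixCoeff (M : RightComodule k C V) (l : Module.Dual k V) : V →ₗ[k] C :=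
  leftSlice l ∘ₗ M.coact

/-- The matrix coefficient `v ↦ l(v₀) v₋₁` of a left comodule. -/
def LeftComodule.matrixCoeff (M : LeftComodule k C V) (l : Module.Dual k V) : V →ₗ[k] C :=
  rightSlice l ∘ₗ M.coact

theorem RightComodule.isColinear_matrixCoeff (M : RightComodule k C V) (l : Module.Dual k V) :
    IsColinear M (RightComodule.regular k C) (M.matrixCoeff l) := by
  change Coalgebra.comul ∘ₗ leftSlice l ∘ₗ M.coact = (leftSlice l ∘ₗ M.coact).rTensor C ∘ₗ M.coact
  rw [← LinearMap.comp_assoc, ← leftSlice_comp_lTensor, LinearMap.comp_assoc, ← M.coassoc,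
    ← LinearMap.comp_assoc, leftSlice_comp_assoc, LinearMap.rTensor_comp, LinearMap.comp_assoc]

theorem LeftComodule.comul_comp_matrixCoeff (M : LeftComodule k C V) (l : Module.Dual k V) :
    Coalgebra.comul ∘ₗ M.matrixCoeff l = (M.matrixCoeff l).lTensor C ∘ₗ M.coact := by
  rw [LeftComodule.matrixCoeff, ← LinearMap.comp_assoc, ← rightSlice_comp_rTensor,
    LinearMap.lTensor_comp, LinearMap.comp_assoc, LinearMap.comp_assoc, ← M.coassoc,
    ← lTensor_rightSlice_comp_assoc, LinearMap.comp_assoc]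

theorem RightComodule.counit_comp_matrixCoeff (M : RightComodule k C V) (l : Module.Dual k V) :
    Coalgebra.counit ∘ₗ M.matrixCoeff l = l := by
  rw [RightComodule.matrixCoeff, ← LinearMap.comp_assoc, ← leftSlice_comp_lTensor,
    LinearMap.comp_assoc, M.counit]
  ext v
  simp

theorem RightComodule.matrixCoeff_corestrict (M : RightComodule k C V) (f : C →ₗc[k] D)
    (l : Module.Dual k V) : (M.corestrict f).matrixCoeff l = f.toLinearMap ∘ₗ M.matrixCoeff l := by
  change leftSlice l ∘ₗ f.toLinearMap.lTensor V ∘ₗ M.coact = _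
  rw [← LinearMap.comp_assoc, leftSlice_comp_lTensor, LinearMap.comp_assoc,
    RightComodule.matrixCoeff]

end MatrixCoefficients

section Intertwining

variable {R : Type*} [CommSemiring R]
variable {C : Type*} [AddCommMonoid C] [Module R C]
variable {U : Type*} [AddCommMonoid U] [Module R U]
variable {V : Type*} [AddCommMonoid V] [Module R V]
variable {i : U →ₗ[R] V} {ρ : U →ₗ[R] U ⊗[R] C} {σ : V →ₗ[R] V ⊗[R] C}

theorem lTensor_comp_comp_of_comp_eq {E : Type*} [AddCommMonoid E] [Module R E]
    (h : σ ∘ₗ i = i.rTensor C ∘ₗ ρ) (g : C →ₗ[R] E) :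
    (g.lTensor V ∘ₗ σ) ∘ₗ i = i.rTensor E ∘ₗ g.lTensor U ∘ₗ ρ := by
  rw [LinearMap.comp_assoc, h, ← LinearMap.comp_assoc, LinearMap.lTensor_comp_rTensor,
    ← LinearMap.rTensor_comp_lTensor, LinearMap.comp_assoc]

theorem assoc_comp_rTensor_comp_comp_of_comp_eq (h : σ ∘ₗ i = i.rTensor C ∘ₗ ρ) :
    ((TensorProduct.assoc R V C C).toLinearMap ∘ₗ σ.rTensor C ∘ₗ σ) ∘ₗ i =
      i.rTensor (C ⊗[R] C) ∘ₗ (TensorProduct.assoc R U C C).toLinearMap ∘ₗ ρ.rTensor C ∘ₗ ρ := by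
  have hassoc : (TensorProduct.assoc R V C C).toLinearMap ∘ₗ (i.rTensor C).rTensor C =
      i.rTensor (C ⊗[R] C) ∘ₗ (TensorProduct.assoc R U C C).toLinearMap := by
    ext
    simp
  have hσ : σ.rTensor C ∘ₗ i.rTensor C = (i.rTensor C).rTensor C ∘ₗ ρ.rTensor C := by
    rw [← LinearMap.rTensor_comp, h, LinearMap.rTensor_comp]
  rw [LinearMap.comp_assoc, LinearMap.comp_assoc, h, ← LinearMap.comp_assoc _ (i.rTensor C), hσ,
    LinearMap.comp_assoc, ← LinearMap.comp_assoc, hassoc, LinearMap.comp_assoc]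

end Intertwining

section Subcomodules

variable {k : Type*} [Field k]
variable {C : Type*} [AddCommGroup C] [Module k C] [Coalgebra k C]
variable {U : Type*} [AddCommGroup U] [Module k U]
variable {V : Type*} [AddCommGroup V] [Module k V]

namespace RightComodule

/-- The comodule structure on `U` induced by an injection into a comodule `V` whose coaction
restricts to `ρ`. -/
def ofInjective (M : RightComodule k C V) (i : U →ₗ[k] V) (hi : Function.Injective i)
    (ρ : U →ₗ[k] U ⊗[k] C) (hρ : M.coact ∘ₗ i = i.rTensor C ∘ₗ ρ) : RightComodule k C U where
  coact := ρ
  coassoc := by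
    have hinj := Module.Flat.rTensor_preserves_injective_linearMap (M := C ⊗[k] C) i hi
    rw [← LinearMap.cancel_left hinj, ← assoc_comp_rTensor_comp_comp_of_comp_eq hρ, M.coassoc,
      lTensor_comp_comp_of_comp_eq hρ]
  counit := by
    have hinj := Module.Flat.rTensor_preserves_injective_linearMap (M := k) i hi
    rw [← LinearMap.cancel_left hinj, ← lTensor_comp_comp_of_comp_eq hρ, M.counit]
    rfl

variable (M : RightComodule k C V)

/-- `N` is a subcomodule of `V`: the coaction maps it into `N ⊗ C ⊆ V ⊗ C`. -/
def IsSubcomodule (N : Submodule k V) : Prop :=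
  ∀ v ∈ N, M.coact v ∈ LinearMap.range (N.subtype.rTensor C)

variable {M} in
theorem IsSubcomodule.sup {N N' : Submodule k V} (hN : M.IsSubcomodule N)
    (hN' : M.IsSubcomodule N') : M.IsSubcomodule (N ⊔ N') := by
  intro v hv
  obtain ⟨x, hx, y, hy, rfl⟩ := Submodule.mem_sup.1 hv
  rw [mem_range_rTensor_subtype_iff]
  intro α
  rw [map_add, map_add]
  exact Submodule.add_mem_sup (mem_range_rTensor_subtype_iff.1 (hN x hx) α)
    (mem_range_rTensor_subtype_iff.1 (hN' y hy) α)

variable {M} in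
theorem IsSubcomodule.exists_isColinear_subtype {N : Submodule k V} (hN : M.IsSubcomodule N) :
    ∃ M' : RightComodule k C N, IsColinear M' M N.subtype := by
  have hinj := Module.Flat.rTensor_preserves_injective_linearMap (M := C) _ N.injective_subtype
  let e := LinearEquiv.ofInjective (N.subtype.rTensor C) hinj
  let ρ : N →ₗ[k] N ⊗[k] C :=
    e.symm.toLinearMap ∘ₗ (M.coact ∘ₗ N.subtype).codRestrict _ fun v => hN v v.2
  have hρ : M.coact ∘ₗ N.subtype = N.subtype.rTensor C ∘ₗ ρ :=
    LinearMap.ext fun v => (congrArg Subtype.val (e.apply_symm_apply ⟨_, hN v v.2⟩)).symm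
  exact ⟨M.ofInjective N.subtype N.injective_subtype ρ hρ, hρ⟩

theorem rightSlice_coact_rightSlice (α β : Module.Dual k C) (v : V) :
    rightSlice β (M.coact (rightSlice α (M.coact v))) =
      rightSlice (TensorProduct.lid k k ∘ₗ TensorProduct.map β α ∘ₗ Coalgebra.comul)
        (M.coact v) := by
  have hassoc : rightSlice α ∘ₗ (rightSlice β).rTensor C =
      rightSlice (TensorProduct.lid k k ∘ₗ TensorProduct.map β α) ∘ₗ
        (TensorProduct.assoc k V C C).toLinearMap := by
    ext
    simp [smul_smul, mul_comm]
  have hcomul : rightSlice (TensorProduct.lid k k ∘ₗ TensorProduct.map β α) ∘ₗ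
      Coalgebra.comul.lTensor V =
        rightSlice (TensorProduct.lid k k ∘ₗ TensorProduct.map β α ∘ₗ Coalgebra.comul) := by
    ext
    simp
  have hα := LinearMap.congr_fun (rightSlice_comp_rTensor α (rightSlice β ∘ₗ M.coact)) (M.coact v)
  have hM := LinearMap.congr_fun M.coassoc v
  have hassocv := LinearMap.congr_fun hassoc (M.coact.rTensor C (M.coact v))
  have hcomulv := LinearMap.congr_fun hcomul (M.coact v)
  simp only [LinearMap.rTensor_comp, LinearMap.comp_apply] at hα hassocv hcomulv hM
  rw [← hα, hassocv, hM, hcomulv]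

theorem rightSlice_counit_coact (v : V) : rightSlice Coalgebra.counit (M.coact v) = v := by
  have hv : Coalgebra.counit.lTensor V (M.coact v) = v ⊗ₜ[k] 1 := LinearMap.congr_fun M.counit v
  change TensorProduct.rid k V (Coalgebra.counit.lTensor V (M.coact v)) = v
  rw [hv, TensorProduct.rid_tmul, one_smul]

theorem exists_fg_isSubcomodule_mem (v : V) :
    ∃ N : Submodule k V, N.FG ∧ M.IsSubcomodule N ∧ v ∈ N := by
  refine ⟨LinearMap.range (rightSlice.flip (M.coact v)), fg_range_rightSlice_flip _, ?_,
    Coalgebra.counit, M.rightSlice_counit_coact v⟩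
  rintro _ ⟨α, rfl⟩
  rw [mem_range_rTensor_subtype_iff]
  intro β
  exact ⟨_, (M.rightSlice_coact_rightSlice α β v).symm⟩

theorem exists_fg_isSubcomodule_ge {U : Submodule k V} (hU : U.FG) :
    ∃ N : Submodule k V, N.FG ∧ M.IsSubcomodule N ∧ U ≤ N := by
  induction U, hU using Submodule.fg_induction with
  | singleton v =>
    obtain ⟨N, hfg, hN, hv⟩ := M.exists_fg_isSubcomodule_mem v
    exact ⟨N, hfg, hN, (Submodule.span_singleton_le_iff_mem v N).2 hv⟩
  | sup U₁ U₂ _ _ h₁ h₂ =>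
    obtain ⟨N₁, hfg₁, hN₁, hU₁⟩ := h₁
    obtain ⟨N₂, hfg₂, hN₂, hU₂⟩ := h₂
    exact ⟨N₁ ⊔ N₂, hfg₁.sup hfg₂, hN₁.sup hN₂, sup_le_sup hU₁ hU₂⟩

end RightComodule

end Subcomodules

section CounitMaps

variable {k : Type*} [Field k]
variable {C : Type*} [AddCommGroup C] [Module k C] [Coalgebra k C]
variable {E : Type*} [AddCommGroup E] [Module k E] [Coalgebra k E]

@[simp]
theorem idTensorCounit_tmul (x y : C) :
    idTensorCounit k C (x ⊗ₜ[k] y) = Coalgebra.counit (R := k) y • x := rfl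

@[simp]
theorem counitTensorId_tmul (x y : C) :
    counitTensorId k C (x ⊗ₜ[k] y) = Coalgebra.counit (R := k) x • y := rfl

theorem idTensorCounit_comul (x : C) : idTensorCounit k C (Coalgebra.comul x) = x := by
  simp [idTensorCounit]

theorem counitTensorId_comul (x : C) : counitTensorId k C (Coalgebra.comul x) = x := by
  simp [counitTensorId]

theorem idTensorCounit_comp_map (g h : E →ₗc[k] C) :
    idTensorCounit k C ∘ₗ TensorProduct.map g.toLinearMap h.toLinearMap =
      g.toLinearMap ∘ₗ idTensorCounit k E := by
  ext
  simp

theorem counitTensorId_comp_map (g h : E →ₗc[k] C) :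
    counitTensorId k C ∘ₗ TensorProduct.map g.toLinearMap h.toLinearMap =
      h.toLinearMap ∘ₗ counitTensorId k E := by
  ext
  simp

end CounitMaps

section Comatrix

open Matrix

section CommRing

variable {R : Type*} [CommRing R] {ι : Type*} [Fintype ι] [DecidableEq ι]
variable {C : Type*} [AddCommGroup C] [Module R C] [Coalgebra R C]

/-- The comultiplication `E_ij ↦ ∑ l, E_il ⊗ E_lj` of the comatrix coalgebra. -/
noncomputable def comatrixComul : Matrix ι ι R →ₗ[R] Matrix ι ι R ⊗[R] Matrix ι ι R :=
  (Matrix.stdBasis R ι ι).constr R fun p => ∑ l, single p.1 l 1 ⊗ₜ[R] single l p.2 1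

theorem comatrixComul_single (i j : ι) :
    comatrixComul (single i j (1 : R)) = ∑ l, single i l 1 ⊗ₜ[R] single l j 1 := by
  rw [comatrixComul, ← Matrix.stdBasis_eq_single, Module.Basis.constr_basis]

theorem trace_single_one (i j : ι) : trace (single i j (1 : R)) = if i = j then 1 else 0 := by
  rcases eq_or_ne i j with rfl | hij
  · simp
  · simp [hij]

/-- The comatrix coalgebra, dual to the matrix algebra; its counit `E_ij ↦ δ_ij` is the trace. -/
noncomputable scoped instance comatrixCoalgebra : Coalgebra R (Matrix ι ι R) where
  comul := comatrixComul
  counit := Matrix.traceLinearMap ι R R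
  coassoc := by
    refine Matrix.ext_linearMap R fun i j => LinearMap.ext_ring ?_
    simp only [LinearMap.coe_comp, LinearEquiv.coe_coe, Function.comp_apply, singleLinearMap_apply,
      comatrixComul_single, map_sum, LinearMap.rTensor_tmul, TensorProduct.sum_tmul,
      TensorProduct.assoc_tmul, LinearMap.lTensor_tmul, TensorProduct.tmul_sum]
    exact Finset.sum_comm
  rTensor_counit_comp_comul := by
    refine Matrix.ext_linearMap R fun i j => LinearMap.ext_ring ?_
    simp [comatrixComul_single, trace_single_one, TensorProduct.ite_tmul]
  lTensor_counit_comp_comul := by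
    refine Matrix.ext_linearMap R fun i j => LinearMap.ext_ring ?_
    simp [comatrixComul_single, trace_single_one, TensorProduct.tmul_ite]

/-- A multiplicative matrix over a coalgebra: coalgebra morphisms from a comatrix coalgebra
correspond to such matrices, formed by the images of the matrix units. -/
structure IsMultiplicative (c : Matrix ι ι C) : Prop where
  comul_apply (i j : ι) : Coalgebra.comul (R := R) (c i j) = ∑ l, c i l ⊗ₜ[R] c l j
  counit_apply (i j : ι) : Coalgebra.counit (R := R) (c i j) = (1 : Matrix ι ι R) i j

theorem IsMultiplicative.exists_comatrix_hom {c : Matrix ι ι C}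
    (hc : IsMultiplicative (R := R) c) :
    ∃ φ : Matrix ι ι R →ₗc[R] C, ∀ i j, φ (single i j 1) = c i j := by
  let φ := (Matrix.stdBasis R ι ι).constr R fun p => c p.1 p.2
  have hφ (i j : ι) : φ (single i j 1) = c i j := by
    rw [← Matrix.stdBasis_eq_single, Module.Basis.constr_basis]
  refine ⟨{ toLinearMap := φ, counit_comp := ?_, map_comp_comul := ?_ }, hφ⟩
  all_goals refine Matrix.ext_linearMap R fun i j => LinearMap.ext_ring ?_
  · change Coalgebra.counit (φ (single i j 1)) = trace (single i j 1)
    rw [hφ, hc.counit_apply, trace_single_one, Matrix.one_apply]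
  · change TensorProduct.map φ φ (comatrixComul (single i j 1)) =
      Coalgebra.comul (φ (single i j 1))
    simp [comatrixComul_single, hφ, hc.comul_apply]

theorem comatrix_hom_ext {φ ψ : Matrix ι ι R →ₗc[R] C}
    (h : ∀ i j, φ (single i j 1) = ψ (single i j 1)) : φ = ψ :=
  CoalgHom.coe_linearMap_injective <| Matrix.ext_linearMap R fun i j => LinearMap.ext_ring (h i j)

theorem comul_one_eq_sum :
    Coalgebra.comul (1 : Matrix ι ι R) =
      ∑ i, ∑ j, single i j (1 : R) ⊗ₜ[R] single j i (1 : R) := by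
  rw [← sum_single_one, map_sum]
  exact Finset.sum_congr rfl fun i _ => comatrixComul_single i i

theorem comm_comul_one :
    TensorProduct.comm R _ _ (Coalgebra.comul (1 : Matrix ι ι R)) =
      Coalgebra.comul (1 : Matrix ι ι R) := by
  simp only [comul_one_eq_sum, map_sum, TensorProduct.comm_tmul]
  exact Finset.sum_comm

theorem leftSlice_coord_comul_one (i j : ι) :
    leftSlice ((Matrix.stdBasis R ι ι).coord (i, j)) (Coalgebra.comul (1 : Matrix ι ι R)) =
      single j i 1 := by
  simp [comul_one_eq_sum, ← Matrix.stdBasis_eq_single, Finsupp.single_apply, ite_and]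

end CommRing

variable {k : Type*} [Field k] {ι : Type*}
variable {C : Type*} [AddCommGroup C] [Module k C] [Coalgebra k C]
variable {D : Type*} [AddCommGroup D] [Module k D] [Coalgebra k D]
variable {V : Type*} [AddCommGroup V] [Module k V]

namespace RightComodule

variable (M N : RightComodule k C V) (b : Module.Basis ι k V)

/-- The matrix `c` of a coaction in a basis: `b_j ↦ ∑ i, b_i ⊗ c_ij`. -/
noncomputable def coeffMatrix : Matrix ι ι C := of fun i j => M.matrixCoeff (b.coord i) (b j)

theorem coeffMatrix_corestrict (f : C →ₗc[k] D) (i j : ι) :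
    (M.corestrict f).coeffMatrix b i j = f (M.coeffMatrix b i j) :=
  LinearMap.congr_fun (M.matrixCoeff_corestrict f (b.coord i)) (b j)

variable {M N} in
theorem eq_of_coeffMatrix_eq (h : M.coeffMatrix b = N.coeffMatrix b) : M = N :=
  RightComodule.ext <| b.ext fun j => eq_of_leftSlice_coord_eq b fun i =>
    congr_fun (congr_fun h i) j

variable [Fintype ι]

theorem coact_basis (j : ι) : M.coact (b j) = ∑ i, b i ⊗ₜ[k] M.coeffMatrix b i j := by
  classical
  refine eq_of_leftSlice_coord_eq b fun i => ?_
  simp [Finsupp.single_apply, coeffMatrix, matrixCoeff]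

theorem isMultiplicative_coeffMatrix [DecidableEq ι] :
    IsMultiplicative (R := k) (M.coeffMatrix b) where
  comul_apply i j := by
    have h := LinearMap.congr_fun (M.isColinear_matrixCoeff (b.coord i)) (b j)
    rw [LinearMap.comp_apply, LinearMap.comp_apply, coact_basis, map_sum] at h
    exact h
  counit_apply i j := by
    have h := LinearMap.congr_fun (M.counit_comp_matrixCoeff (b.coord i)) (b j)
    refine h.trans ?_
    rw [Module.Basis.coord_apply, Module.Basis.repr_self, Finsupp.single_apply, Matrix.one_apply]
    simp only [eq_comm]

end RightComodule

theorem exists_comatrix_hom_apply_eq (x : C) :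
    ∃ (n : ℕ) (φ : Matrix (Fin n) (Fin n) k →ₗc[k] C) (a : Matrix (Fin n) (Fin n) k), φ a = x := by
  obtain ⟨N, hfg, hN, hx⟩ := (RightComodule.regular k C).exists_fg_isSubcomodule_mem x
  obtain ⟨M, hM⟩ := hN.exists_isColinear_subtype
  have : Module.Finite k N := Module.Finite.iff_fg.2 hfg
  let b := Module.finBasis k N
  obtain ⟨φ, hφ⟩ := (M.isMultiplicative_coeffMatrix b).exists_comatrix_hom
  let y : N := ⟨x, hx⟩
  have hy : M.coact y = ∑ j, b.repr y j • ∑ i, b i ⊗ₜ[k] M.coeffMatrix b i j := by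
    conv_lhs => rw [← b.sum_repr y, map_sum]
    simp only [map_smul, M.coact_basis b]
  have hxy : Coalgebra.comul x = N.subtype.rTensor C (M.coact y) := LinearMap.congr_fun hM y
  refine ⟨_, φ, ∑ j, b.repr y j • ∑ i, Coalgebra.counit (R := k) (b i : C) • single i j 1, ?_⟩
  calc φ (∑ j, b.repr y j • ∑ i, Coalgebra.counit (R := k) (b i : C) • single i j 1)
      = ∑ j, b.repr y j • ∑ i, Coalgebra.counit (R := k) (b i : C) • M.coeffMatrix b i j := by
        simp only [map_sum, map_smul, hφ]
    _ = counitTensorId k C (Coalgebra.comul x) := by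
        rw [hxy, hy]
        simp only [map_sum, map_smul, LinearMap.rTensor_tmul, counitTensorId_tmul,
          Submodule.subtype_apply]
    _ = x := counitTensorId_comul x

end Comatrix

section CoalgebraLimits

open Limits

variable {k : Type u} [Field k]

theorem isSeparating_comatrix : (ObjectProperty.ofObj fun n : ℕ =>
    CoalgCat.of k (Matrix (Fin n) (Fin n) k)).IsSeparating := by
  intro X Y g h hgh
  refine CoalgCat.hom_ext _ _ (CoalgHom.ext fun x => ?_)
  obtain ⟨n, φ, a, rfl⟩ := exists_comatrix_hom_apply_eq (k := k) x
  exact CoalgHom.congr_fun congr(($(hgh _ ⟨n⟩ (CoalgCat.ofHom φ))).toCoalgHom) a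

instance hasLimits_coalgCat : HasLimits (CoalgCat.{u} k) :=
  hasLimits_of_hasColimits_of_isSeparating isSeparating_comatrix

end CoalgebraLimits

section Shear

variable {R : Type*} [Semiring R]
variable {V : Type*} [AddCommMonoid V] [Module R V]
variable {W : Type*} [AddCommGroup W] [Module R W]

/-- The shear `(v, w) ↦ (v, w + φ v)`, an automorphism of `V × W`. -/
def shear (φ : V →ₗ[R] W) : (V × W) ≃ₗ[R] V × W :=
  (LinearEquiv.refl R V).skewProd (LinearEquiv.refl R W) φ

end Shear

section Transport

variable {k : Type*} [Field k]
variable {C : Type*} [AddCommGroup C] [Module k C] [Coalgebra k C]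
variable {D : Type*} [AddCommGroup D] [Module k D] [Coalgebra k D]
variable {V : Type*} [AddCommGroup V] [Module k V]
variable {W : Type*} [AddCommGroup W] [Module k W]

namespace RightComodule

/-- Transport of a comodule structure along a linear equivalence. -/
def congr (M : RightComodule k C V) (e : V ≃ₗ[k] W) : RightComodule k C W :=
  M.ofInjective e.symm.toLinearMap e.symm.injective
    (e.toLinearMap.rTensor C ∘ₗ M.coact ∘ₗ e.symm.toLinearMap) <| by
      rw [← LinearMap.comp_assoc, ← LinearMap.rTensor_comp, e.symm_comp, LinearMap.rTensor_id,
        LinearMap.id_comp]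

theorem congr_corestrict (M : RightComodule k C V) (e : V ≃ₗ[k] W) (f : C →ₗc[k] D) :
    (M.congr e).corestrict f = (M.corestrict f).congr e := by
  ext1
  change f.toLinearMap.lTensor W ∘ₗ e.toLinearMap.rTensor C ∘ₗ M.coact ∘ₗ e.symm.toLinearMap =
    e.toLinearMap.rTensor D ∘ₗ (f.toLinearMap.lTensor V ∘ₗ M.coact) ∘ₗ e.symm.toLinearMap
  simp only [← LinearMap.comp_assoc, LinearMap.lTensor_comp_rTensor, LinearMap.rTensor_comp_lTensor]

theorem isColinear_iff_congr_eq {M : RightComodule k C V} {N : RightComodule k C W}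
    {e : V ≃ₗ[k] W} : IsColinear M N e.toLinearMap ↔ M.congr e = N := by
  rw [RightComodule.ext_iff, IsColinear, eq_comm, ← LinearEquiv.comp_toLinearMap_symm_eq]
  rfl

/-- The direct sum of two comodules. -/
def prod (M : RightComodule k C V) (N : RightComodule k C W) : RightComodule k C (V × W) where
  coact := ((LinearMap.inl k V W).rTensor C ∘ₗ M.coact).coprod
    ((LinearMap.inr k V W).rTensor C ∘ₗ N.coact)
  coassoc := by
    refine LinearMap.prod_ext ?_ ?_
    · rw [assoc_comp_rTensor_comp_comp_of_comp_eq (LinearMap.coprod_inl _ _), M.coassoc,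
        lTensor_comp_comp_of_comp_eq (LinearMap.coprod_inl _ _)]
    · rw [assoc_comp_rTensor_comp_comp_of_comp_eq (LinearMap.coprod_inr _ _), N.coassoc,
        lTensor_comp_comp_of_comp_eq (LinearMap.coprod_inr _ _)]
  counit := by
    refine LinearMap.prod_ext ?_ ?_
    · rw [lTensor_comp_comp_of_comp_eq (LinearMap.coprod_inl _ _), M.counit]
      rfl
    · rw [lTensor_comp_comp_of_comp_eq (LinearMap.coprod_inr _ _), N.counit]
      rfl

theorem prod_corestrict (M : RightComodule k C V) (N : RightComodule k C W) (f : C →ₗc[k] D) :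
    (M.prod N).corestrict f = (M.corestrict f).prod (N.corestrict f) := by
  ext1
  refine LinearMap.prod_ext ?_ ?_
  · exact (lTensor_comp_comp_of_comp_eq (LinearMap.coprod_inl _ _) _).trans
      (LinearMap.coprod_inl _ _).symm
  · exact (lTensor_comp_comp_of_comp_eq (LinearMap.coprod_inr _ _) _).trans
      (LinearMap.coprod_inr _ _).symm

end RightComodule

namespace IsColinear

variable {U : Type*} [AddCommGroup U] [Module k U]
variable {L : RightComodule k C U} {M : RightComodule k C V} {N : RightComodule k C W}

theorem id : IsColinear M M LinearMap.id := by
  rw [IsColinear, LinearMap.comp_id, LinearMap.rTensor_id, LinearMap.id_comp]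

theorem zero : IsColinear M N 0 := by
  rw [IsColinear, LinearMap.comp_zero, LinearMap.rTensor_zero, LinearMap.zero_comp]

theorem comp {ψ : V →ₗ[k] W} {φ : U →ₗ[k] V} (hψ : IsColinear M N ψ) (hφ : IsColinear L M φ) :
    IsColinear L N (ψ ∘ₗ φ) := by
  rw [IsColinear, ← LinearMap.comp_assoc, hψ, LinearMap.comp_assoc, hφ, LinearMap.rTensor_comp,
    LinearMap.comp_assoc]

theorem of_comp {ψ : V →ₗ[k] W} {φ : U →ₗ[k] V} (hψ : IsColinear M N ψ)
    (hinj : Function.Injective ψ) (h : IsColinear L N (ψ ∘ₗ φ)) : IsColinear L M φ := by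
  have hinj := Module.Flat.rTensor_preserves_injective_linearMap (M := C) ψ hinj
  rw [IsColinear, ← LinearMap.cancel_left hinj, ← LinearMap.comp_assoc, ← hψ, LinearMap.comp_assoc,
    h, LinearMap.rTensor_comp, LinearMap.comp_assoc]

theorem corestrict {φ : V →ₗ[k] W} (h : IsColinear M N φ) (f : C →ₗc[k] D) :
    IsColinear (M.corestrict f) (N.corestrict f) φ := lTensor_comp_comp_of_comp_eq h _

theorem add {φ ψ : V →ₗ[k] W} (hφ : IsColinear M N φ) (hψ : IsColinear M N ψ) :
    IsColinear M N (φ + ψ) := by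
  rw [IsColinear, LinearMap.comp_add, hφ, hψ, LinearMap.rTensor_add, LinearMap.add_comp]

theorem inl : IsColinear M (M.prod N) (LinearMap.inl k V W) := LinearMap.coprod_inl _ _

theorem inr : IsColinear N (M.prod N) (LinearMap.inr k V W) := LinearMap.coprod_inr _ _

theorem coprod {φ : V →ₗ[k] U} {ψ : W →ₗ[k] U} (hφ : IsColinear M L φ) (hψ : IsColinear N L ψ) :
    IsColinear (M.prod N) L (φ.coprod ψ) := by
  have hl : (M.prod N).coact ∘ₗ LinearMap.inl k V W = _ := inl
  have hr : (M.prod N).coact ∘ₗ LinearMap.inr k V W = _ := inr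
  refine LinearMap.prod_ext ?_ ?_
  · rw [LinearMap.comp_assoc, LinearMap.comp_assoc, LinearMap.coprod_inl, hl, hφ,
      ← LinearMap.comp_assoc, ← LinearMap.rTensor_comp, LinearMap.coprod_inl]
  · rw [LinearMap.comp_assoc, LinearMap.comp_assoc, LinearMap.coprod_inr, hr, hψ,
      ← LinearMap.comp_assoc, ← LinearMap.rTensor_comp, LinearMap.coprod_inr]

theorem snd : IsColinear (M.prod N) N (LinearMap.snd k V W) := by
  rw [LinearMap.snd_eq_coprod]
  exact zero.coprod id

end IsColinear

theorem isColinear_shear_iff {M : RightComodule k C V} {N : RightComodule k C W}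
    {φ : V →ₗ[k] W} :
    IsColinear (M.prod N) (M.prod N) (shear φ).toLinearMap ↔ IsColinear M N φ := by
  have hφ : LinearMap.snd k V W ∘ₗ (shear φ).toLinearMap ∘ₗ LinearMap.inl k V W = φ := by
    ext
    simp [shear]
  have hshear : (shear φ).toLinearMap =
      (LinearMap.inl k V W + LinearMap.inr k V W ∘ₗ φ).coprod (LinearMap.inr k V W) := by
    ext <;> simp [shear]
  constructor
  · intro h
    rw [← hφ]
    exact IsColinear.snd.comp (h.comp IsColinear.inl)
  · intro h
    rw [hshear]
    exact (IsColinear.inl.add (IsColinear.inr.comp h)).coprod IsColinear.inr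

end Transport

section Cotensor

variable {k : Type*} [Field k]
variable {C : Type*} [AddCommGroup C] [Module k C] [Coalgebra k C]
variable {D : Type*} [AddCommGroup D] [Module k D] [Coalgebra k D]
variable {E : Type*} [AddCommGroup E] [Module k E] [Coalgebra k E]
variable {V : Type*} [AddCommGroup V] [Module k V]
variable {W : Type*} [AddCommGroup W] [Module k W]

variable (V C) in
/-- The cofree right comodule `V ⊗ C`, with coaction `v ⊗ c ↦ v ⊗ c₁ ⊗ c₂`. -/
def RightComodule.cofree : RightComodule k C (V ⊗[k] C) where
  coact := (TensorProduct.assoc k V C C).symm.toLinearMap ∘ₗ Coalgebra.comul.lTensor V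
  coassoc := by
    have hpentagon : (TensorProduct.assoc k (V ⊗[k] C) C C).toLinearMap ∘ₗ
        (TensorProduct.assoc k V C C).symm.toLinearMap.rTensor C ∘ₗ
          (TensorProduct.assoc k V (C ⊗[k] C) C).symm.toLinearMap =
        (TensorProduct.assoc k V C (C ⊗[k] C)).symm.toLinearMap ∘ₗ
          (TensorProduct.assoc k C C C).toLinearMap.lTensor V := by
      ext
      simp
    have hcomul : (Coalgebra.comul.lTensor V).rTensor C ∘ₗ
          (TensorProduct.assoc k V C C).symm.toLinearMap =
        (TensorProduct.assoc k V (C ⊗[k] C) C).symm.toLinearMap ∘ₗ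
          (Coalgebra.comul.rTensor C).lTensor V := by
      ext
      simp
    have hcomul' : Coalgebra.comul.lTensor (V ⊗[k] C) ∘ₗ
          (TensorProduct.assoc k V C C).symm.toLinearMap =
        (TensorProduct.assoc k V C (C ⊗[k] C)).symm.toLinearMap ∘ₗ
          (Coalgebra.comul.lTensor C).lTensor V := by
      ext
      simp
    rw [← LinearMap.comp_assoc _ _ (Coalgebra.comul.lTensor _), hcomul', LinearMap.comp_assoc,
      ← LinearMap.lTensor_comp, ← Coalgebra.coassoc, LinearMap.rTensor_comp, LinearMap.comp_assoc,
      ← LinearMap.comp_assoc _ _ ((Coalgebra.comul.lTensor V).rTensor C), hcomul,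
      LinearMap.lTensor_comp,
      ← LinearMap.comp_assoc _ _ (TensorProduct.assoc k V C _).symm.toLinearMap, ← hpentagon,
      LinearMap.lTensor_comp]
    simp only [LinearMap.comp_assoc]
  counit := by
    have hcounit : Coalgebra.counit.lTensor (V ⊗[k] C) ∘ₗ
          (TensorProduct.assoc k V C C).symm.toLinearMap =
        (TensorProduct.assoc k V C k).symm.toLinearMap ∘ₗ
          (Coalgebra.counit.lTensor C).lTensor V := by
      ext
      simp
    rw [← LinearMap.comp_assoc, hcounit, LinearMap.comp_assoc, ← LinearMap.lTensor_comp,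
      Coalgebra.lTensor_counit_comp_comul]
    ext
    simp

theorem lTensor_mem_cotensor {M : RightComodule k D V} {N : LeftComodule k D W} {g : W →ₗ[k] W}
    (hg : N.coact ∘ₗ g = g.lTensor D ∘ₗ N.coact) {t : V ⊗[k] W} (ht : t ∈ cotensor M N) :
    g.lTensor V t ∈ cotensor M N := by
  have hassoc : (TensorProduct.assoc k V D W).toLinearMap ∘ₗ g.lTensor (V ⊗[k] D) =
      (g.lTensor D).lTensor V ∘ₗ (TensorProduct.assoc k V D W).toLinearMap := by
    ext
    simp
  have hM : ((TensorProduct.assoc k V D W).toLinearMap ∘ₗ M.coact.rTensor W) ∘ₗ g.lTensor V =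
      (g.lTensor D).lTensor V ∘ₗ (TensorProduct.assoc k V D W).toLinearMap ∘ₗ
        M.coact.rTensor W := by
    rw [LinearMap.comp_assoc, LinearMap.rTensor_comp_lTensor, ← LinearMap.lTensor_comp_rTensor,
      ← LinearMap.comp_assoc, hassoc, LinearMap.comp_assoc]
  have hN : N.coact.lTensor V ∘ₗ g.lTensor V = (g.lTensor D).lTensor V ∘ₗ N.coact.lTensor V := by
    rw [← LinearMap.lTensor_comp, hg, LinearMap.lTensor_comp]
  rw [cotensor, LinearMap.mem_eqLocus] at ht ⊢
  rw [← LinearMap.comp_apply, ← LinearMap.comp_apply, hM, hN, LinearMap.comp_apply, ht,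
    LinearMap.comp_apply]

variable (f : C →ₗc[k] D)

theorem isSubcomodule_selfCotensor :
    (RightComodule.cofree C C).IsSubcomodule (selfCotensor f) := by
  intro t ht
  rw [mem_range_rTensor_subtype_iff]
  intro α
  let g := (LeftComodule.regular k C).matrixCoeff α
  have hslice : rightSlice α ∘ₗ (RightComodule.cofree C C).coact = g.lTensor C := by
    rw [RightComodule.cofree, ← LinearMap.comp_assoc, rightSlice_comp_assoc_symm,
      ← LinearMap.lTensor_comp]
    rfl
  have hg : ((LeftComodule.regular k C).corestrict f).coact ∘ₗ g =
      g.lTensor D ∘ₗ ((LeftComodule.regular k C).corestrict f).coact := by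
    have hcomul := (LeftComodule.regular k C).comul_comp_matrixCoeff α
    change (f.toLinearMap.rTensor C ∘ₗ Coalgebra.comul) ∘ₗ g =
      g.lTensor D ∘ₗ f.toLinearMap.rTensor C ∘ₗ Coalgebra.comul
    rw [LinearMap.comp_assoc, hcomul, ← LinearMap.comp_assoc, ← LinearMap.comp_assoc,
      LinearMap.rTensor_comp_lTensor, LinearMap.lTensor_comp_rTensor]
    rfl
  rw [← LinearMap.comp_apply, hslice]
  exact lTensor_mem_cotensor hg ht

theorem lTensor_comul_idTensorCounit {t : C ⊗[k] C} (ht : t ∈ selfCotensor f) :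
    f.toLinearMap.lTensor C (Coalgebra.comul (idTensorCounit k C t)) =
      f.toLinearMap.lTensor C t := by
  let ε : Module.Dual k C := Coalgebra.counit
  have hleft : (rightSlice ε).lTensor C ∘ₗ (TensorProduct.assoc k C D C).toLinearMap ∘ₗ
        (f.toLinearMap.lTensor C ∘ₗ Coalgebra.comul).rTensor C =
      f.toLinearMap.lTensor C ∘ₗ Coalgebra.comul ∘ₗ idTensorCounit k C := by
    rw [← LinearMap.comp_assoc, lTensor_rightSlice_comp_assoc, rightSlice_comp_rTensor]
    rfl
  have hcounit : rightSlice ε ∘ₗ f.toLinearMap.rTensor C ∘ₗ Coalgebra.comul = f.toLinearMap := by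
    rw [← LinearMap.comp_assoc, rightSlice_comp_rTensor]
    exact LinearMap.ext fun x => congrArg f (idTensorCounit_comul x)
  have hright : (rightSlice ε).lTensor C ∘ₗ
      (f.toLinearMap.rTensor C ∘ₗ Coalgebra.comul).lTensor C = f.toLinearMap.lTensor C := by
    rw [← LinearMap.lTensor_comp, hcounit]
  have ht := congrArg ((rightSlice ε).lTensor C) ht
  exact (LinearMap.congr_fun hleft t).symm.trans (ht.trans (LinearMap.congr_fun hright t))

theorem rTensor_idTensorCounit_comp_coact_cofree :
    (idTensorCounit k C).rTensor D ∘ₗ ((RightComodule.cofree C C).corestrict f).coact =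
      f.toLinearMap.lTensor C := by
  have hassoc : (idTensorCounit k C).rTensor C ∘ₗ
      (TensorProduct.assoc k C C C).symm.toLinearMap = (counitTensorId k C).lTensor C := by
    ext
    simp [TensorProduct.smul_tmul]
  have hcomul : counitTensorId k C ∘ₗ Coalgebra.comul = LinearMap.id :=
    LinearMap.ext counitTensorId_comul
  change (idTensorCounit k C).rTensor D ∘ₗ f.toLinearMap.lTensor (C ⊗[k] C) ∘ₗ
    (TensorProduct.assoc k C C C).symm.toLinearMap ∘ₗ Coalgebra.comul.lTensor C = _
  rw [← LinearMap.comp_assoc, LinearMap.rTensor_comp_lTensor, ← LinearMap.lTensor_comp_rTensor,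
    LinearMap.comp_assoc, ← LinearMap.comp_assoc _ _ ((idTensorCounit k C).rTensor C), hassoc,
    ← LinearMap.lTensor_comp, hcomul, LinearMap.lTensor_id, LinearMap.comp_id]

theorem map_comul_mem_selfCotensor {g h : E →ₗc[k] C} (hgh : f.comp g = f.comp h) (x : E) :
    TensorProduct.map g.toLinearMap h.toLinearMap (Coalgebra.comul x) ∈ selfCotensor f := by
  have hf : f.toLinearMap ∘ₗ g.toLinearMap = f.toLinearMap ∘ₗ h.toLinearMap :=
    congrArg CoalgHom.toLinearMap hgh
  have hassoc : (TensorProduct.assoc k C D C).toLinearMap ∘ₗ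
        TensorProduct.map (TensorProduct.map g.toLinearMap (f.toLinearMap ∘ₗ g.toLinearMap))
          h.toLinearMap =
      TensorProduct.map g.toLinearMap
          (TensorProduct.map (f.toLinearMap ∘ₗ g.toLinearMap) h.toLinearMap) ∘ₗ
        (TensorProduct.assoc k E E E).toLinearMap := by
    ext
    simp
  have hg : (f.toLinearMap.lTensor C ∘ₗ Coalgebra.comul) ∘ₗ g.toLinearMap =
      TensorProduct.map g.toLinearMap (f.toLinearMap ∘ₗ g.toLinearMap) ∘ₗ Coalgebra.comul := by
    rw [LinearMap.comp_assoc, ← g.map_comp_comul, ← LinearMap.comp_assoc,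
      LinearMap.lTensor_comp_map]
  have hh : (f.toLinearMap.rTensor C ∘ₗ Coalgebra.comul) ∘ₗ h.toLinearMap =
      TensorProduct.map (f.toLinearMap ∘ₗ g.toLinearMap) h.toLinearMap ∘ₗ Coalgebra.comul := by
    rw [LinearMap.comp_assoc, ← h.map_comp_comul, ← LinearMap.comp_assoc,
      LinearMap.rTensor_comp_map, hf]
  suffices hmap : ((TensorProduct.assoc k C D C).toLinearMap ∘ₗ
        (f.toLinearMap.lTensor C ∘ₗ Coalgebra.comul).rTensor C) ∘ₗ
          TensorProduct.map g.toLinearMap h.toLinearMap ∘ₗ Coalgebra.comul =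
      (f.toLinearMap.rTensor C ∘ₗ Coalgebra.comul).lTensor C ∘ₗ
        TensorProduct.map g.toLinearMap h.toLinearMap ∘ₗ Coalgebra.comul from
    LinearMap.congr_fun hmap x
  rw [LinearMap.comp_assoc, ← LinearMap.comp_assoc _ _ (LinearMap.rTensor _ _),
    LinearMap.rTensor_comp_map, hg, ← LinearMap.map_comp_rTensor, LinearMap.comp_assoc,
    ← LinearMap.comp_assoc, hassoc, LinearMap.comp_assoc, Coalgebra.coassoc,
    ← LinearMap.comp_assoc _ _ (LinearMap.lTensor _ _), LinearMap.lTensor_comp_map, hh,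
    ← LinearMap.map_comp_lTensor, LinearMap.comp_assoc]

end Cotensor

section BicomoduleCoefficients

variable {k : Type*} [Field k]
variable {C : Type*} [AddCommGroup C] [Module k C] [Coalgebra k C]
variable {D : Type*} [AddCommGroup D] [Module k D] [Coalgebra k D]
variable {X : Type*} [AddCommGroup X] [Module k X]

/- A cyclic rotation of the tensor factors turns the cotensor condition into centrality of `t` in
the bicomodule `C ⊗ C`. -/
theorem comm_mem_selfCotensor_iff {f : C →ₗc[k] D} {t : C ⊗[k] C} :
    TensorProduct.comm k C C t ∈ selfCotensor f ↔
      f.toLinearMap.lTensor (C ⊗[k] C) ((RightComodule.cofree C C).coact t) =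
        TensorProduct.comm k D (C ⊗[k] C) (f.toLinearMap.rTensor (C ⊗[k] C)
          (TensorProduct.assoc k C C C (Coalgebra.comul.rTensor C t))) := by
  let rotate : (C ⊗[k] C) ⊗[k] D ≃ₗ[k] C ⊗[k] (D ⊗[k] C) :=
    TensorProduct.assoc k C C D ≪≫ₗ TensorProduct.comm k C (C ⊗[k] D) ≪≫ₗ
      TensorProduct.assoc k C D C
  have hright : (TensorProduct.assoc k C D C).toLinearMap ∘ₗ
        (f.toLinearMap.lTensor C).rTensor C ∘ₗ
          (TensorProduct.comm k C (C ⊗[k] C)).toLinearMap =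
      rotate.toLinearMap ∘ₗ f.toLinearMap.lTensor (C ⊗[k] C) ∘ₗ
        (TensorProduct.assoc k C C C).symm.toLinearMap := by
    ext
    simp [rotate]
  have hleft : (f.toLinearMap.rTensor C).lTensor C ∘ₗ
        (TensorProduct.comm k (C ⊗[k] C) C).toLinearMap =
      rotate.toLinearMap ∘ₗ (TensorProduct.comm k D (C ⊗[k] C)).toLinearMap ∘ₗ
        f.toLinearMap.rTensor (C ⊗[k] C) ∘ₗ (TensorProduct.assoc k C C C).toLinearMap := by
    ext
    simp [rotate]
  have hl : ((TensorProduct.assoc k C D C).toLinearMap ∘ₗ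
        (f.toLinearMap.lTensor C ∘ₗ Coalgebra.comul).rTensor C) (TensorProduct.comm k C C t) =
      rotate (f.toLinearMap.lTensor (C ⊗[k] C) ((RightComodule.cofree C C).coact t)) := by
    rw [LinearMap.rTensor_comp, LinearMap.comp_apply, LinearMap.comp_apply,
      LinearMap.rTensor_comm]
    exact LinearMap.congr_fun hright (Coalgebra.comul.lTensor C t)
  have hr : (f.toLinearMap.rTensor C ∘ₗ Coalgebra.comul).lTensor C (TensorProduct.comm k C C t) =
      rotate (TensorProduct.comm k D (C ⊗[k] C) (f.toLinearMap.rTensor (C ⊗[k] C)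
          (TensorProduct.assoc k C C C (Coalgebra.comul.rTensor C t)))) := by
    rw [LinearMap.lTensor_comp, LinearMap.comp_apply, LinearMap.lTensor_comm]
    exact LinearMap.congr_fun hleft (Coalgebra.comul.rTensor C t)
  rw [← rotate.injective.eq_iff, ← hl, ← hr]
  rfl

namespace Bicomodule

variable (B : Bicomodule k C X) (l : Module.Dual k X)

/-- The two-sided matrix coefficient `x ↦ x₋₁ ⊗ l(x₀) x₁` of a bicomodule. -/
def matrixCoeff : X →ₗ[k] C ⊗[k] C :=
  (B.right.matrixCoeff l).lTensor C ∘ₗ B.left.coact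

theorem matrixCoeff_eq_rTensor_comp_coact :
    B.matrixCoeff l = (B.left.matrixCoeff l).rTensor C ∘ₗ B.right.coact := by
  have hslice : (leftSlice l).lTensor C ∘ₗ (TensorProduct.assoc k C X C).toLinearMap =
      (rightSlice l).rTensor C := by
    ext
    simp [TensorProduct.smul_tmul]
  rw [matrixCoeff, RightComodule.matrixCoeff, LinearMap.lTensor_comp, LinearMap.comp_assoc,
    ← B.comm, ← LinearMap.comp_assoc, hslice, LeftComodule.matrixCoeff, LinearMap.rTensor_comp,
    LinearMap.comp_assoc]

theorem isColinear_matrixCoeff :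
    IsColinear B.right (RightComodule.cofree C C) (B.matrixCoeff l) := by
  have hassoc : (TensorProduct.assoc k C C C).symm.toLinearMap ∘ₗ
        ((B.right.matrixCoeff l).rTensor C).lTensor C ∘ₗ
          (TensorProduct.assoc k C X C).toLinearMap =
      ((B.right.matrixCoeff l).lTensor C).rTensor C := by
    ext
    simp
  have hr : Coalgebra.comul ∘ₗ B.right.matrixCoeff l =
      (B.right.matrixCoeff l).rTensor C ∘ₗ B.right.coact := B.right.isColinear_matrixCoeff l
  rw [IsColinear, RightComodule.cofree, matrixCoeff, LinearMap.comp_assoc, ← LinearMap.comp_assoc,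
    LinearMap.comp_assoc, ← LinearMap.comp_assoc _ _ (LinearMap.lTensor C _),
    ← LinearMap.lTensor_comp, hr, LinearMap.lTensor_comp, LinearMap.comp_assoc, ← B.comm,
    LinearMap.rTensor_comp, ← hassoc]
  simp only [LinearMap.comp_assoc]

theorem assoc_comp_comul_comp_matrixCoeff :
    (TensorProduct.assoc k C C C).toLinearMap ∘ₗ Coalgebra.comul.rTensor C ∘ₗ B.matrixCoeff l =
      (B.matrixCoeff l).lTensor C ∘ₗ B.left.coact := by
  have hassoc : (TensorProduct.assoc k C C C).toLinearMap ∘ₗ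
        ((B.left.matrixCoeff l).lTensor C).rTensor C =
      ((B.left.matrixCoeff l).rTensor C).lTensor C ∘ₗ
        (TensorProduct.assoc k C X C).toLinearMap := by
    ext
    simp
  have hl := B.left.comul_comp_matrixCoeff l
  rw [matrixCoeff_eq_rTensor_comp_coact, ← LinearMap.comp_assoc _ _ (LinearMap.rTensor C _),
    ← LinearMap.rTensor_comp, hl, LinearMap.rTensor_comp, LinearMap.comp_assoc,
    ← LinearMap.comp_assoc, hassoc, LinearMap.comp_assoc, B.comm, LinearMap.lTensor_comp,
    LinearMap.comp_assoc]

theorem idTensorCounit_comm_matrixCoeff (x : X) :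
    idTensorCounit k C (TensorProduct.comm k C C (B.matrixCoeff l x)) =
      B.right.matrixCoeff l x := by
  have hcounit : idTensorCounit k C ∘ₗ (TensorProduct.comm k C C).toLinearMap ∘ₗ
        (B.right.matrixCoeff l).lTensor C =
      B.right.matrixCoeff l ∘ₗ (TensorProduct.lid k X).toLinearMap ∘ₗ
        Coalgebra.counit.rTensor X := by
    ext
    simp
  have hx : Coalgebra.counit.rTensor X (B.left.coact x) = 1 ⊗ₜ[k] x :=
    LinearMap.congr_fun B.left.counit x
  refine (LinearMap.congr_fun hcounit (B.left.coact x)).trans ?_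
  simp only [LinearMap.comp_apply, hx, LinearEquiv.coe_coe, TensorProduct.lid_tmul, one_smul]

theorem counitTensorId_comm_matrixCoeff (x : X) :
    counitTensorId k C (TensorProduct.comm k C C (B.matrixCoeff l x)) =
      B.left.matrixCoeff l x := by
  have hcounit : counitTensorId k C ∘ₗ (TensorProduct.comm k C C).toLinearMap ∘ₗ
        (B.left.matrixCoeff l).rTensor C =
      B.left.matrixCoeff l ∘ₗ (TensorProduct.rid k X).toLinearMap ∘ₗ
        Coalgebra.counit.lTensor X := by
    ext
    simp
  have hx : Coalgebra.counit.lTensor X (B.right.coact x) = x ⊗ₜ[k] 1 :=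
    LinearMap.congr_fun B.right.counit x
  rw [matrixCoeff_eq_rTensor_comp_coact]
  refine (LinearMap.congr_fun hcounit (B.right.coact x)).trans ?_
  simp only [LinearMap.comp_apply, hx, LinearEquiv.coe_coe, TensorProduct.rid_tmul, one_smul]

variable {B} in
theorem IsCentral.comm_matrixCoeff_mem_selfCotensor {f : C →ₗc[k] D} {x : X}
    (hx : B.IsCentral f x) :
    TensorProduct.comm k C C (B.matrixCoeff l x) ∈ selfCotensor f := by
  rw [comm_mem_selfCotensor_iff]
  calc f.toLinearMap.lTensor (C ⊗[k] C) ((RightComodule.cofree C C).coact (B.matrixCoeff l x))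
      = (B.matrixCoeff l).rTensor D (f.toLinearMap.lTensor X (B.right.coact x)) :=
        LinearMap.congr_fun ((B.isColinear_matrixCoeff l).corestrict f) x
    _ = (B.matrixCoeff l).rTensor D
          (TensorProduct.comm k D X (f.toLinearMap.rTensor X (B.left.coact x))) :=
        congrArg _ hx
    _ = TensorProduct.comm k D (C ⊗[k] C) (f.toLinearMap.rTensor (C ⊗[k] C)
          ((B.matrixCoeff l).lTensor C (B.left.coact x))) := by
        rw [LinearMap.rTensor_comm, ← LinearMap.comp_apply, LinearMap.lTensor_comp_rTensor,
          ← LinearMap.rTensor_comp_lTensor, LinearMap.comp_apply]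
    _ = TensorProduct.comm k D (C ⊗[k] C) (f.toLinearMap.rTensor (C ⊗[k] C)
          (TensorProduct.assoc k C C C (Coalgebra.comul.rTensor C (B.matrixCoeff l x)))) :=
        congrArg (fun t => TensorProduct.comm k D (C ⊗[k] C) (f.toLinearMap.rTensor (C ⊗[k] C) t))
          (LinearMap.congr_fun (B.assoc_comp_comul_comp_matrixCoeff l) x).symm

end Bicomodule

end BicomoduleCoefficients

section ComatrixBicomodules

open Matrix

variable {k : Type*} [Field k]
variable {C : Type*} [AddCommGroup C] [Module k C] [Coalgebra k C]
variable {D : Type*} [AddCommGroup D] [Module k D] [Coalgebra k D]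
variable {E : Type*} [AddCommGroup E] [Module k E] [Coalgebra k E]
variable {ι : Type*} [Fintype ι] [DecidableEq ι]

/-- The coalgebra `E` as a `C`-bicomodule, coacting on the left through `g` and on the right
through `h`. -/
def Bicomodule.ofHoms (g h : E →ₗc[k] C) : Bicomodule k C E where
  left := (LeftComodule.regular k E).corestrict g
  right := (RightComodule.regular k E).corestrict h
  comm := by
    have hassoc : (TensorProduct.assoc k C E C).toLinearMap ∘ₗ
        (g.toLinearMap.rTensor E).rTensor C ∘ₗ h.toLinearMap.lTensor (E ⊗[k] E) =
        (h.toLinearMap.lTensor E).lTensor C ∘ₗ g.toLinearMap.rTensor (E ⊗[k] E) ∘ₗ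
          (TensorProduct.assoc k E E E).toLinearMap := by
      ext
      simp
    change (TensorProduct.assoc k C E C).toLinearMap ∘ₗ
        (g.toLinearMap.rTensor E ∘ₗ Coalgebra.comul).rTensor C ∘ₗ
          h.toLinearMap.lTensor E ∘ₗ Coalgebra.comul =
      (h.toLinearMap.lTensor E ∘ₗ Coalgebra.comul).lTensor C ∘ₗ
        g.toLinearMap.rTensor E ∘ₗ Coalgebra.comul
    have hcomul :=
      congrArg (fun φ => φ ∘ₗ Coalgebra.comul.rTensor E ∘ₗ Coalgebra.comul) hassoc
    simp only [LinearMap.comp_assoc, LinearMap.rTensor_comp, LinearMap.lTensor_comp] at hcomul ⊢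
    rw [← LinearMap.comp_assoc _ (h.toLinearMap.lTensor E), LinearMap.rTensor_comp_lTensor,
      ← LinearMap.lTensor_comp_rTensor, LinearMap.comp_assoc, hcomul, Coalgebra.coassoc,
      ← LinearMap.comp_assoc _ _ (g.toLinearMap.rTensor (E ⊗[k] E)),
      LinearMap.rTensor_comp_lTensor, ← LinearMap.lTensor_comp_rTensor, LinearMap.comp_assoc]

theorem isCentral_one_iff {g h : Matrix ι ι k →ₗc[k] C} {f : C →ₗc[k] D} :
    (Bicomodule.ofHoms g h).IsCentral f 1 ↔ f.comp g = f.comp h := by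
  let t : Matrix ι ι k ⊗[k] Matrix ι ι k := Coalgebra.comul (1 : Matrix ι ι k)
  have hright : f.toLinearMap.lTensor _ ((Bicomodule.ofHoms g h).right.coact 1) =
      (f.comp h).toLinearMap.lTensor _ t := (LinearMap.lTensor_comp_apply _ _ _ _).symm
  have hleft : TensorProduct.comm k D _
      (f.toLinearMap.rTensor _ ((Bicomodule.ofHoms g h).left.coact 1)) =
        (f.comp g).toLinearMap.lTensor _ t := by
    have ht : TensorProduct.comm k _ _ t = t := comm_comul_one
    rw [← ht, LinearMap.lTensor_comm]
    exact congrArg _ (LinearMap.rTensor_comp_apply _ _ _ _).symm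
  rw [Bicomodule.IsCentral, hright, hleft]
  constructor
  · intro hgh
    refine comatrix_hom_ext fun i j => ?_
    have hslice := congrArg (leftSlice ((Matrix.stdBasis k ι ι).coord (j, i))) hgh
    simp only [← LinearMap.comp_apply, leftSlice_comp_lTensor] at hslice
    simp only [LinearMap.comp_apply, t, leftSlice_coord_comul_one] at hslice
    exact hslice.symm
  · intro hgh
    rw [hgh]

end ComatrixBicomodules

section Conditions

open Matrix Limits

variable {k : Type u} [Field k]
variable {C : Type u} [AddCommGroup C] [Module k C] [Coalgebra k C]
variable {D : Type u} [AddCommGroup D] [Module k D] [Coalgebra k D]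
variable {D' : Type u} [AddCommGroup D'] [Module k D'] [Coalgebra k D']
variable {f : C →ₗc[k] D} {π : C →ₗc[k] D'}

theorem equalizesPairs_iff_forall_comp_eq_comp : EqualizesPairs f π ↔
    ∀ ⦃P : CoalgCat.{u} k⦄ (a b : P ⟶ CoalgCat.of k C),
      a ≫ CoalgCat.ofHom f = b ≫ CoalgCat.ofHom f →
        a ≫ CoalgCat.ofHom π = b ≫ CoalgCat.ofHom π where
  mp h P a b hab :=
    CoalgCat.hom_ext _ _ (h P a.toCoalgHom b.toCoalgHom congr(($hab).toCoalgHom))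
  mpr h C' _ _ _ f₁ f₂ h₁₂ :=
    congr(($(h (P := CoalgCat.of k C') (CoalgCat.ofHom f₁) (CoalgCat.ofHom f₂)
      (CoalgCat.hom_ext _ _ h₁₂))).toCoalgHom)

theorem dominates_iff_equalizesPairs :
    Dominates (CoalgCat.ofHom f) (CoalgCat.ofHom π) ↔ EqualizesPairs f π := by
  rw [dominates_iff_forall_comp_eq_comp, equalizesPairs_iff_forall_comp_eq_comp]

theorem coequalizesPullback_iff_equalizesPairs :
    CoequalizesPullback f π ↔ EqualizesPairs f π := by
  rw [equalizesPairs_iff_forall_comp_eq_comp]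
  constructor
  · rintro ⟨P, p₁, p₂, hP, hπ⟩ Q a b hab
    rw [← hP.lift_fst a b hab, Category.assoc, hπ, hP.lift_snd_assoc]
  · intro h
    exact ⟨_, _, _, IsPullback.of_hasPullback _ _, h _ _ pullback.condition⟩

variable {V : Type*} [AddCommGroup V] [Module k V]
variable {W : Type*} [AddCommGroup W] [Module k W]

namespace EqualizesPairs

theorem corestrict_eq [FiniteDimensional k V] (h : EqualizesPairs f π)
    {M N : RightComodule k C V} (hMN : M.corestrict f = N.corestrict f) :
    M.corestrict π = N.corestrict π := by
  let b := Module.finBasis k V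
  obtain ⟨φ, hφ⟩ := (M.isMultiplicative_coeffMatrix b).exists_comatrix_hom
  obtain ⟨ψ, hψ⟩ := (N.isMultiplicative_coeffMatrix b).exists_comatrix_hom
  have hf : f.comp φ = f.comp ψ := comatrix_hom_ext fun i j => by
    rw [CoalgHom.comp_apply, CoalgHom.comp_apply, hφ, hψ, ← M.coeffMatrix_corestrict,
      ← N.coeffMatrix_corestrict, hMN]
  refine RightComodule.eq_of_coeffMatrix_eq b (Matrix.ext fun i j => ?_)
  rw [M.coeffMatrix_corestrict, N.coeffMatrix_corestrict, ← hφ, ← hψ]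
  exact CoalgHom.congr_fun (h _ φ ψ hf) (single i j 1)

theorem isColinear_equiv [FiniteDimensional k W] (h : EqualizesPairs f π)
    {M : RightComodule k C V} {N : RightComodule k C W} {e : V ≃ₗ[k] W}
    (he : IsColinear (M.corestrict f) (N.corestrict f) e.toLinearMap) :
    IsColinear (M.corestrict π) (N.corestrict π) e.toLinearMap := by
  rw [RightComodule.isColinear_iff_congr_eq, ← RightComodule.congr_corestrict] at he ⊢
  exact h.corestrict_eq he

theorem finiteColinearCondition (h : EqualizesPairs f π) : FiniteColinearCondition f π := by
  intro V W _ _ _ _ _ _ M N φ hφ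
  rw [← isColinear_shear_iff, ← RightComodule.prod_corestrict] at hφ ⊢
  exact h.isColinear_equiv hφ

end EqualizesPairs

theorem FiniteColinearCondition.colinearCondition (h : FiniteColinearCondition f π) :
    ColinearCondition f π := by
  intro V W _ _ _ _ M N φ hφ
  refine LinearMap.ext fun v => ?_
  obtain ⟨V', hV', hsubV, hv⟩ := M.exists_fg_isSubcomodule_mem v
  obtain ⟨W', hW', hsubW, hVW⟩ := N.exists_fg_isSubcomodule_ge (hV'.map φ)
  have : FiniteDimensional k V' := Module.Finite.iff_fg.2 hV'
  have : FiniteDimensional k W' := Module.Finite.iff_fg.2 hW'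
  obtain ⟨M', hM'⟩ := hsubV.exists_isColinear_subtype
  obtain ⟨N', hN'⟩ := hsubW.exists_isColinear_subtype
  let ψ : V' →ₗ[k] W' := φ.restrict fun x hx => hVW ⟨x, hx, rfl⟩
  have hφψ : φ ∘ₗ V'.subtype = W'.subtype ∘ₗ ψ := rfl
  have hψ : IsColinear (M'.corestrict f) (N'.corestrict f) ψ :=
    (hN'.corestrict f).of_comp W'.injective_subtype (hφψ ▸ hφ.comp (hM'.corestrict f))
  have hψπ : IsColinear (M'.corestrict π) (N.corestrict π) (φ ∘ₗ V'.subtype) :=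
    (hN'.corestrict π).comp (h _ _ _ _ _ hψ)
  have hφV : (N.corestrict π).coact ∘ₗ φ ∘ₗ V'.subtype =
      φ.rTensor D' ∘ₗ (M.corestrict π).coact ∘ₗ V'.subtype := by
    rw [hψπ, hM'.corestrict π, LinearMap.rTensor_comp, LinearMap.comp_assoc]
  exact LinearMap.congr_fun hφV ⟨v, hv⟩

theorem ColinearCondition.coequalizesCotensor (h : ColinearCondition f π) :
    CoequalizesCotensor f π := by
  obtain ⟨M, hM⟩ := (isSubcomodule_selfCotensor f).exists_isColinear_subtype
  have hiff {E : Type u} [AddCommGroup E] [Module k E] [Coalgebra k E] (g : C →ₗc[k] E) :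
      IsColinear (M.corestrict g) ((RightComodule.regular k C).corestrict g)
        (idTensorCounit k C ∘ₗ (selfCotensor f).subtype) ↔
      ∀ t ∈ selfCotensor f, g.toLinearMap.lTensor C (Coalgebra.comul (idTensorCounit k C t)) =
        g.toLinearMap.lTensor C t := by
    rw [IsColinear, LinearMap.rTensor_comp, LinearMap.comp_assoc, ← hM.corestrict g,
      ← LinearMap.comp_assoc _ ((RightComodule.cofree C C).corestrict g).coact,
      rTensor_idTensorCounit_comp_coact_cofree, LinearMap.ext_iff, Subtype.forall]
    rfl
  have hπ := (hiff π).1 (h _ _ _ _ _ ((hiff f).2 fun t => lTensor_comul_idTensorCounit f))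
  have hcounit := leftSlice_comp_lTensor (Coalgebra.counit : Module.Dual k C) π.toLinearMap
  refine LinearMap.ext fun ⟨t, ht⟩ => ?_
  calc π (idTensorCounit k C t)
      = π (counitTensorId k C (Coalgebra.comul (idTensorCounit k C t))) := by
        rw [counitTensorId_comul]
    _ = leftSlice Coalgebra.counit
          (π.toLinearMap.lTensor C (Coalgebra.comul (idTensorCounit k C t))) :=
        (LinearMap.congr_fun hcounit _).symm
    _ = leftSlice Coalgebra.counit (π.toLinearMap.lTensor C t) := by rw [hπ t ht]
    _ = π (counitTensorId k C t) := LinearMap.congr_fun hcounit t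

theorem CoequalizesCotensor.equalizesPairs (h : CoequalizesCotensor f π) :
    EqualizesPairs f π := by
  intro E _ _ _ f₁ f₂ hf
  ext x
  have hx := LinearMap.congr_fun h ⟨_, map_comul_mem_selfCotensor f hf x⟩
  have hfst := LinearMap.congr_fun (idTensorCounit_comp_map f₁ f₂) (Coalgebra.comul x)
  have hsnd := LinearMap.congr_fun (counitTensorId_comp_map f₁ f₂) (Coalgebra.comul x)
  simp only [LinearMap.comp_apply, idTensorCounit_comul, counitTensorId_comul] at hfst hsnd
  simp only [LinearMap.comp_apply, Submodule.subtype_apply, hfst, hsnd] at hx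
  exact hx

theorem CoequalizesCotensor.bicomoduleCondition (h : CoequalizesCotensor f π) :
    BicomoduleCondition f π := by
  intro X _ _ B x hx
  refine eq_of_leftSlice_eq fun l => ?_
  have hcomm : leftSlice l ∘ₗ (TensorProduct.comm k D' X).toLinearMap ∘ₗ
      π.toLinearMap.rTensor X = π.toLinearMap ∘ₗ rightSlice l := by
    ext
    simp
  have hright := LinearMap.congr_fun (leftSlice_comp_lTensor l π.toLinearMap) (B.right.coact x)
  have hleft := LinearMap.congr_fun hcomm (B.left.coact x)
  have hl := LinearMap.congr_fun h ⟨_, hx.comm_matrixCoeff_mem_selfCotensor l⟩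
  simp only [LinearMap.comp_apply, Submodule.subtype_apply, B.idTensorCounit_comm_matrixCoeff,
    B.counitTensorId_comm_matrixCoeff] at hl
  exact hright.trans (hl.trans hleft.symm)

theorem BicomoduleCondition.finiteBicomoduleCondition (h : BicomoduleCondition f π) :
    FiniteBicomoduleCondition f π := fun X _ _ _ B x hx => h X B x hx

theorem FiniteBicomoduleCondition.equalizesPairs (h : FiniteBicomoduleCondition f π) :
    EqualizesPairs f π := by
  intro E _ _ _ f₁ f₂ hf
  ext x
  obtain ⟨n, φ, a, rfl⟩ := exists_comatrix_hom_apply_eq (k := k) x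
  have hφ : f.comp (f₁.comp φ) = f.comp (f₂.comp φ) := congrArg (fun g => g.comp φ) hf
  exact CoalgHom.congr_fun (isCentral_one_iff.1 (h _ _ _ (isCentral_one_iff.2 hφ))) a

end Conditions

end CoalgDom

theorem mainTheorem9_general {k : Type u} [Field k]
    {C : Type u} [AddCommGroup C] [Module k C] [Coalgebra k C]
    {D : Type u} [AddCommGroup D] [Module k D] [Coalgebra k D]
    {D' : Type u} [AddCommGroup D'] [Module k D'] [Coalgebra k D']
    (f : C →ₗc[k] D) (π : C →ₗc[k] D') :
    List.TFAE
      [ CoalgDom.Dominates (CoalgCat.ofHom f) (CoalgCat.ofHom π),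
        CoalgDom.EqualizesPairs f π,
        CoalgDom.CoequalizesPullback f π,
        CoalgDom.CoequalizesCotensor f π,
        CoalgDom.BicomoduleCondition f π,
        CoalgDom.FiniteBicomoduleCondition f π,
        CoalgDom.ColinearCondition f π,
        CoalgDom.FiniteColinearCondition f π ] ∧
    ((∃ g : D' →ₗc[k] D, g.comp π = f) →
      List.TFAE
        [ CoalgDom.DominatesBetween (CoalgCat.ofHom f) (CoalgCat.ofHom π),
          CoalgDom.EqualizesPairs f π,
          CoalgDom.CoequalizesPullback f π,
          CoalgDom.CoequalizesCotensor f π,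
          CoalgDom.BicomoduleCondition f π,
          CoalgDom.FiniteBicomoduleCondition f π,
          CoalgDom.ColinearCondition f π,
          CoalgDom.FiniteColinearCondition f π ]) := by
  refine (and_iff_left_of_imp ?_).2 ?_
  · rintro htfae ⟨g, rfl⟩
    have hg : ∃ g', CoalgCat.ofHom π ≫ g' = CoalgCat.ofHom (g.comp π) := ⟨CoalgCat.ofHom g, rfl⟩
    rwa [CoalgDom.dominatesBetween_iff_dominates hg]
  · tfae_have 1 ↔ 2 := CoalgDom.dominates_iff_equalizesPairs
    tfae_have 3 ↔ 2 := CoalgDom.coequalizesPullback_iff_equalizesPairs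
    tfae_have 2 → 8 := CoalgDom.EqualizesPairs.finiteColinearCondition
    tfae_have 8 → 7 := CoalgDom.FiniteColinearCondition.colinearCondition
    tfae_have 7 → 4 := CoalgDom.ColinearCondition.coequalizesCotensor
    tfae_have 4 → 2 := CoalgDom.CoequalizesCotensor.equalizesPairs
    tfae_have 4 → 5 := CoalgDom.CoequalizesCotensor.bicomoduleCondition
    tfae_have 5 → 6 := CoalgDom.BicomoduleCondition.finiteBicomoduleCondition
    tfae_have 6 → 2 := CoalgDom.FiniteBicomoduleCondition.equalizesPairs
    tfae_finish

theorem mainTheorem9 {k : Type u} [Field k]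
    {C : Type u} [AddCommGroup C] [Module k C] [Coalgebra k C]
    {D : Type u} [AddCommGroup D] [Module k D] [Coalgebra k D]
    {D' : Type u} [AddCommGroup D'] [Module k D'] [Coalgebra k D']
    (f : C →ₗc[k] D) (π : C →ₗc[k] D') (hπ : Function.Surjective π) :
    List.TFAE
      [ CoalgDom.Dominates (CoalgCat.ofHom f) (CoalgCat.ofHom π),
        CoalgDom.EqualizesPairs f π,
        CoalgDom.CoequalizesPullback f π,
        CoalgDom.CoequalizesCotensor f π,
        CoalgDom.BicomoduleCondition f π,
        CoalgDom.FiniteBicomoduleCondition f π,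
        CoalgDom.ColinearCondition f π,
        CoalgDom.FiniteColinearCondition f π ] ∧
    ((∃ g : D' →ₗc[k] D, g.comp π = f) →
      List.TFAE
        [ CoalgDom.DominatesBetween (CoalgCat.ofHom f) (CoalgCat.ofHom π),
          CoalgDom.EqualizesPairs f π,
          CoalgDom.CoequalizesPullback f π,
          CoalgDom.CoequalizesCotensor f π,
          CoalgDom.BicomoduleCondition f π,
          CoalgDom.FiniteBicomoduleCondition f π,
          CoalgDom.ColinearCondition f π,
          CoalgDom.FiniteColinearCondition f π ]) :=
  mainTheorem9_general f π
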